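/- Let $n\ge 2$ be an integer and let $(\mathbb P^1)^n$ be the $n$-fold product over $\mathbb C$ of the complex projective line. Let $C\subset(\mathbb P^1)^n$ be an integral closed subscheme of dimension one which has multidegree $(d,\dots,d)$; that is, for each $i=1,\dots,n$ the $i$-th projection $\mathrm{pr}_i|_C\colon C\to\mathbb P^1$ has degree $d$ (the degree of a dominant morphism being the degree of the extension of function fields, and the degree of a constant morphism being $0$). Then the geometric genus of $C$, i.e. the dimension $\dim_{\mathbb C}H^0(\tilde C,\Omega^1_{\tilde C})$ of the space of regular differential forms on the normalization $\tilde C$ of $C$, satisfies \[ p_g(C)\le (d-1)^2 . \] -/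

import Mathlib

open CategoryTheory CategoryTheory.Limits AlgebraicGeometry

noncomputable section

namespace CurveGenus

/-! ### The complex projective line and its powers -/

/-- The standard grading of `ℂ[x₀, x₁]` by degree. -/
abbrev P1Grading : ℕ → Submodule ℂ (MvPolynomial (Fin 2) ℂ) :=
  MvPolynomial.homogeneousSubmodule (Fin 2) ℂ

instance : GradedAlgebra P1Grading := MvPolynomial.gradedAlgebra

/-- The complex projective line `Proj ℂ[x₀, x₁]`, as a scheme over `Spec ℂ`. -/
def P1 : Over (Spec (.of ℂ)) :=
  Over.mk (Proj.toSpecZero P1Grading ≫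
    Spec.map (CommRingCat.ofHom (algebraMap ℂ (P1Grading 0))))

/-- The `n`-fold product `(ℙ¹)ⁿ` in the category of schemes over `Spec ℂ`. -/
def P1Pow (n : ℕ) : Over (Spec (.of ℂ)) := ∏ᶜ fun _ : Fin n => P1

/-- The projection of `(ℙ¹)ⁿ` onto its `i`-th factor. -/
def P1Pow.proj (n : ℕ) (i : Fin n) : (P1Pow n).left ⟶ P1.left :=
  (Pi.π (fun _ : Fin n => P1) i).left

theorem algebraMap_grading_zero_bijective :
    Function.Bijective (algebraMap ℂ (P1Grading 0)) := by
  constructor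
  · intro a b h
    exact MvPolynomial.C_injective (Fin 2) ℂ (congrArg Subtype.val h)
  · rintro ⟨p, hp⟩
    have h : p ∈ (1 : Submodule ℂ (MvPolynomial (Fin 2) ℂ)) := by
      rwa [← MvPolynomial.homogeneousSubmodule_zero]
    obtain ⟨c, hc⟩ := Submodule.mem_one.mp h
    exact ⟨c, Subtype.ext hc⟩

instance : IsProper P1.hom := by
  have h : IsIso (CommRingCat.ofHom (algebraMap ℂ (P1Grading 0))) :=
    (ConcreteCategory.isIso_iff_bijective _).mpr algebraMap_grading_zero_bijective
  have : IsScalarTower ℂ (P1Grading 0) (MvPolynomial (Fin 2) ℂ) :=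
    .of_algebraMap_eq (R := ℂ) (S := P1Grading 0) (A := MvPolynomial (Fin 2) ℂ) fun _ => rfl
  have : Algebra.FiniteType (P1Grading 0) (MvPolynomial (Fin 2) ℂ) :=
    .of_restrictScalars_finiteType ℂ _ _
  exact inferInstanceAs (IsProper (Proj.toSpecZero P1Grading ≫
    Spec.map (CommRingCat.ofHom (algebraMap ℂ (P1Grading 0)))))

theorem isProper_of_isLimit_fan {S : Scheme.{0}} : ∀ (n : ℕ) (f : Fin n → Over S)
    (_ : ∀ i, IsProper (f i).hom) (c : Fan f) (_ : IsLimit c), IsProper c.pt.hom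
  | 0, f, _, c, hc => by
    have t : IsTerminal c.pt := IsTerminal.ofUniqueHom
      (fun X => Fan.IsLimit.lift hc (fun i => i.elim0))
      (fun X m => Fan.IsLimit.hom_ext hc _ _ (fun i => i.elim0))
    let e := t.uniqueUpToIso Over.mkIdTerminal
    have h : e.hom.left = c.pt.hom := by simpa using Over.w e.hom
    have : IsIso e.hom.left := ((Over.forget S).mapIso e).isIso_hom
    rw [← h]
    infer_instance
  | n + 1, f, hf, c, hc => by
    let c₁ : Fan fun i : Fin n => f i.succ := limit.cone (Discrete.functor fun i : Fin n => f i.succ)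
    have h1 : IsProper c₁.pt.hom :=
      isProper_of_isLimit_fan n (fun i : Fin n => f i.succ) (fun i => hf i.succ) c₁ (limit.isLimit _)
    have h0 := hf 0
    let c₂ : BinaryFan (f 0) c₁.pt := limit.cone (pair (f 0) c₁.pt)
    have ht := extendFanIsLimit f (limit.isLimit _ : IsLimit c₁) (limit.isLimit _ : IsLimit c₂)
    let e := hc.conePointUniqueUpToIso ht
    have h2 : IsProper c₂.pt.hom := by
      have hp := Over.isPullback_of_binaryFan_isLimit c₂ (limit.isLimit _)
      have : IsProper c₂.fst.left := MorphismProperty.of_isPullback hp.flip h1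
      have h : c₂.fst.left ≫ (f 0).hom = c₂.pt.hom := Over.w c₂.fst
      rw [← h]
      exact MorphismProperty.comp_mem @IsProper _ _ this h0
    have h3 : IsProper (extendFan c₁ c₂).pt.hom := h2
    have : IsIso e.hom.left := ((Over.forget S).mapIso e).isIso_hom
    rw [← Over.w e.hom]
    infer_instance

instance (n : ℕ) : IsProper (P1Pow n).hom :=
  isProper_of_isLimit_fan n (fun _ => P1) (fun _ => inferInstance) _ (limit.isLimit _)

/-! ### Degree of a morphism -/

/-- The degree of a morphism `f : X ⟶ Y` between integral schemes: it is the degree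
`[K(X) : K(Y)]` of the extension of function fields if `f` is dominant, in which case `f` maps the
generic point of `X` to that of `Y`, and it is `0` otherwise. -/
def degree {X Y : Scheme.{0}} [IsIntegral X] (f : X ⟶ Y) : ℕ :=
  letI : Algebra (Y.presheaf.stalk (f (genericPoint X))) X.functionField :=
    (f.stalkMap (genericPoint X)).hom.toAlgebra
  open Classical in
  if IsDominant f then Module.finrank (Y.presheaf.stalk (f (genericPoint X))) X.functionField else 0

/-! ### The geometric genus -/

/-- The normalization of an integral scheme `C`: the relative normalization of `C` in the spectrum
of its function field, that is, the scheme over `C` which over an affine open `U` is the spectrum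
of the integral closure of `Γ(C, U)` in the function field of `C`. -/
def normalization (C : Scheme.{0}) [IsIntegral C] [QuasiSeparatedSpace C] : Scheme.{0} :=
  (C.fromSpecStalk (genericPoint C)).normalization

def normalizationMap (C : Scheme.{0}) [IsIntegral C] [QuasiSeparatedSpace C] :
    normalization C ⟶ C :=
  (C.fromSpecStalk (genericPoint C)).fromNormalization

instance (C : Scheme.{0}) [IsIntegral C] [QuasiSeparatedSpace C] :
    IsIntegral (normalization C) := by
  have : IsIntegral (Spec (C.presheaf.stalk (genericPoint C))) := inferInstance
  unfold normalization; infer_instance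

/-- The structure of `ℂ`-algebra on the local ring at `x` of a scheme over `Spec ℂ`. -/
abbrev stalkAlgebra {X : Scheme.{0}} (π : X ⟶ Spec (.of ℂ)) (x : X) :
    Algebra ℂ (X.presheaf.stalk x) :=
  ((Scheme.ΓSpecIso (.of ℂ)).inv ≫ π.appTop ≫ X.presheaf.germ ⊤ x (TopologicalSpace.Opens.mem_top x)).hom.toAlgebra

theorem stalk_isScalarTower {X : Scheme.{0}} [IsIntegral X] (π : X ⟶ Spec (.of ℂ)) (x : X) :
    letI := stalkAlgebra π x
    letI := stalkAlgebra π (genericPoint X)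
    IsScalarTower ℂ (X.presheaf.stalk x) X.functionField := by
  let _ := stalkAlgebra π x
  let _ := stalkAlgebra π (genericPoint X)
  refine IsScalarTower.of_algebraMap_eq' ?_
  change ((Scheme.ΓSpecIso (.of ℂ)).inv ≫ π.appTop ≫ X.presheaf.germ ⊤ _ (TopologicalSpace.Opens.mem_top _)).hom =
    ((Scheme.ΓSpecIso (.of ℂ)).inv ≫ π.appTop ≫ X.presheaf.germ ⊤ x (TopologicalSpace.Opens.mem_top x) ≫
      X.presheaf.stalkSpecializes ((genericPoint_spec X).specializes trivial)).hom
  rw [X.presheaf.germ_stalkSpecializes]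

/-- The space `H⁰(X, Ω¹)` of regular differential forms of an integral normal scheme `X` of
dimension one and of finite type over `ℂ`: the rational differential forms (the Kähler differentials
of the function field of `X` over `ℂ`) that are regular at each point `x` of `X`, that is, come from
a Kähler differential of the local ring at `x`. -/
def regularDifferentials {X : Scheme.{0}} [IsIntegral X] (π : X ⟶ Spec (.of ℂ)) :
    letI := stalkAlgebra π (genericPoint X)
    Submodule ℂ (Ω[X.functionField⁄ℂ]) :=
  letI := stalkAlgebra π (genericPoint X)
  ⨅ x : X,
    letI := stalkAlgebra π x
    haveI := stalk_isScalarTower π x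
    LinearMap.range
      ((KaehlerDifferential.map ℂ ℂ (X.presheaf.stalk x) X.functionField).restrictScalars ℂ)

/-- The geometric genus of an integral proper curve `C` over `ℂ`, with structure morphism `π`: the
dimension over `ℂ` of the space of regular differential forms on the normalization of `C`. -/
def geometricGenus {C : Scheme.{0}} [IsIntegral C] (π : C ⟶ Spec (.of ℂ)) [IsProper π] : ℕ∞ :=
  haveI : QuasiSeparatedSpace C := quasiSeparatedSpace_of_quasiSeparated π
  letI := stalkAlgebra (normalizationMap C ≫ π) (genericPoint (normalization C))
  Cardinal.toENat (Module.rank ℂ (regularDifferentials (normalizationMap C ≫ π)))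

end CurveGenus

end

/-! The function field `K` of `C` is generated by the coordinates `f₁, …, fₙ`. If they are
nonconstant, each has degree `d`, meaning `[K : ℂ(fᵢ)] = d`; if one of them is constant, `K = ℂ` and
there are no nonzero forms. The bound then follows from a purely field-theoretic genus estimate, by
adjoining the coordinates one at a time.

The inductive step is the Castelnuovo–Severi inequality `g' ≤ e g + (e - 1)(d' - 1)` for `L' =
L(y)`, where `e = [L' : L]` and `d' = [L' : k(y)]` (`finrank_logForms_le_of_adjoin_simple_eq_top`).
To prove it, choose `e - 1` constants `cⱼ` for which `y - cⱼ` has only simple zeros, at most `d'` of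
them. A regular form `ω` on `L'` is sent to the traces of `ω` and of the `ω / (y - cⱼ)`. The first
trace is regular on `L`; the others have at most simple poles, at no more than `d'` places, so each
lies in a space of dimension at most `g + d' - 1`. Partial fractions show that `1` and the `1 / (y -
cⱼ)` span `L'` over `L`; as the trace form is nondegenerate, the map is injective.

The `-1` comes from the fact that no form has exactly one simple pole (`logForms_singleton_le`): its
trace to `k(x)` would have at most one simple pole, hence be zero by an explicit computation with `P
/ Q`, although the residue survives the trace.

Forms are written `h dx` for a fixed `x`. With `τ = x - a`, or `τ = x` at a pole of `x`, one has `h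
dx = (h τ) dτ / τ`. So `h τ` regular means at most a simple pole, `h τ` vanishing means a regular
form, and the value of `h τ` is the residue up to a nonzero integer.

The passage from schemes uses the birationality of normalization, the valuative criterion (each
place has a center on the normalization, so regular differentials lie in `logForms`), and the
universal property of the product (coordinates generate the function field). -/

noncomputable section

namespace CurvePlace

open Polynomial IntermediateField

variable {k L : Type*} [Field k] [Field L] [Algebra k L]

/-! ### Places of a function field of one variable -/

/-- A place of `L/k`: a valuation ring of `L` that contains `k` and is not all of `L`. -/
def IsPlace (k : Type*) {L : Type*} [Field k] [Field L] [Algebra k L] (V : ValuationSubring L) :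
    Prop :=
  (∀ c : k, algebraMap k L c ∈ V) ∧ V ≠ ⊤

theorem trdeg_le_one_of_isAlgebraic {x : L} [Algebra.IsAlgebraic k⟮x⟯ L] :
    Algebra.trdeg k L ≤ 1 := by
  open scoped algebraAdjoinAdjoin in
  have : Algebra.IsAlgebraic (Algebra.adjoin k {x}) L :=
    Algebra.IsAlgebraic.trans _ k⟮x⟯ _
  simpa using Algebra.IsAlgebraic.trdeg_le_cardinalMk k ({x} : Set L)

theorem isAlgebraic_algebraAdjoin (h : Algebra.trdeg k L ≤ 1) {t : L} (ht : Transcendental k t) :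
    Algebra.IsAlgebraic (Algebra.adjoin k {t}) L := by
  have h1 : AlgebraicIndependent k (fun _ : Unit => t) :=
    (algebraicIndependent_unique_type_iff).mpr ht
  have h2 := (h1.isTranscendenceBasis_of_lift_trdeg_le_of_finite (by simpa using h)).isAlgebraic
  rwa [Set.range_const] at h2

theorem isAlgebraic_adjoin (h : Algebra.trdeg k L ≤ 1) {t : L} (ht : Transcendental k t) :
    Algebra.IsAlgebraic k⟮t⟯ L := by
  have := isAlgebraic_algebraAdjoin h ht
  open scoped algebraAdjoinAdjoin in
  exact Algebra.IsAlgebraic.extendScalars (R := Algebra.adjoin k {t}) (S := k⟮t⟯)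
    (FaithfulSMul.algebraMap_injective _ _)

theorem eq_algebraMap_of_isAlgebraic [IsAlgClosed k] {A : Type*} [CommRing A] [IsDomain A]
    [Algebra k A] {u : A} (hu : IsAlgebraic k u) : ∃ c : k, algebraMap k A c = u :=
  minpoly.mem_range_of_degree_eq_one _ _
    (IsAlgClosed.degree_eq_one_of_irreducible k (minpoly.irreducible hu.isIntegral))

theorem transcendental_of_not_mem [IsAlgClosed k] {t : L} (h : ∀ c : k, algebraMap k L c ≠ t) :
    Transcendental k t := fun ht => by
  obtain ⟨c, hc⟩ := eq_algebraMap_of_isAlgebraic ht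
  exact h c hc

namespace IsPlace

variable {V : ValuationSubring L}

theorem valuation_algebraMap (hV : IsPlace k V) {c : k} (hc : c ≠ 0) :
    V.valuation (algebraMap k L c) = 1 := by
  refine le_antisymm ((V.valuation_le_one_iff _).2 (hV.1 c)) ?_
  have h := (V.valuation_le_one_iff _).2 (hV.1 c⁻¹)
  rw [map_inv₀, map_inv₀] at h
  exact (inv_le_one₀ (by simp [zero_lt_iff, hc])).1 h

theorem exists_valuation_lt_one (hV : IsPlace k V) : ∃ t : L, t ≠ 0 ∧ V.valuation t < 1 := by
  by_contra! h
  refine hV.2 (top_le_iff.1 fun z _ => ?_)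
  by_cases hz : z = 0
  · simp [hz]
  have := h z⁻¹ (inv_ne_zero hz)
  rw [map_inv₀, one_le_inv₀ (by simp [zero_lt_iff, hz])] at this
  exact (V.valuation_le_one_iff _).1 this

theorem transcendental [IsAlgClosed k] (hV : IsPlace k V) {t : L} (h0 : t ≠ 0)
    (ht : V.valuation t < 1) : Transcendental k t :=
  transcendental_of_not_mem fun c hc => by
    have : c ≠ 0 := by rintro rfl; simp at hc; exact h0 hc.symm
    rw [← hc, hV.valuation_algebraMap this] at ht
    exact ht.false

/-- Take `t ≠ 0` in the maximal ideal and a relation `P(t, u) = 0`. Once `P` is primitive over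
`k[t]`, setting `t = 0` leaves a nonzero polynomial over `k` that kills the residue of `u`; the
residue is thus algebraic over `k`, hence in `k`. -/
theorem exists_residue [IsAlgClosed k] (htr : Algebra.trdeg k L ≤ 1) (hV : IsPlace k V) {u : L}
    (hu : V.valuation u ≤ 1) : ∃ c : k, V.valuation (u - algebraMap k L c) < 1 := by
  obtain ⟨t, ht0, ht⟩ := hV.exists_valuation_lt_one
  have htt := hV.transcendental ht0 ht
  have := isAlgebraic_algebraAdjoin htr htt
  obtain ⟨p, hp0, hp⟩ := Algebra.IsAlgebraic.isAlgebraic (R := Algebra.adjoin k {t}) u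
  let φ : k[X] →ₐ[k] Algebra.adjoin k {t} :=
    aeval (⟨t, Algebra.self_mem_adjoin_singleton k t⟩ : Algebra.adjoin k {t})
  have hφ' : (Algebra.adjoin k {t}).val.comp φ = aeval t := by ext; simp [φ]
  have hφ : Function.Surjective φ := by
    rintro ⟨z, hz⟩
    obtain ⟨q, rfl⟩ := Algebra.adjoin_mem_exists_aeval k t hz
    exact ⟨q, Subtype.ext (DFunLike.congr_fun hφ' q)⟩
  obtain ⟨P, rfl⟩ := map_surjective φ.toRingHom hφ p
  have hP0 : P ≠ 0 := by rintro rfl; simp at hp0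
  let _ : Algebra k V := ((algebraMap k L).codRestrict V.toSubring hV.1).toAlgebra
  have hVL : ∀ c : k, ((algebraMap k V c : V) : L) = algebraMap k L c := fun _ => rfl
  let t' : V := ⟨t, (V.valuation_le_one_iff _).1 ht.le⟩
  let u' : V := ⟨u, (V.valuation_le_one_iff _).1 hu⟩
  let E : k[X][X] →+* V := eval₂RingHom (aeval t').toRingHom u'
  have hE : ∀ q, V.subtype (E q) = eval₂ (aeval t).toRingHom u q := by
    intro q
    have : V.subtype.comp E = eval₂RingHom (aeval t).toRingHom u := by
      refine Polynomial.ringHom_ext' (Polynomial.ringHom_ext' ?_ ?_) ?_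
      · ext c; simp [E, hVL]
      · simp [E, t']
      · simp [E, u']
    exact RingHom.congr_fun this q
  have hEP : E P = 0 := by
    apply V.subtype_injective
    rw [hE, map_zero, ← hp, aeval_def, eval₂_map]
    congr 1
    rw [← hφ']; rfl
  let _ : NormalizedGCDMonoid k[X] := Classical.arbitrary _
  -- The content is a nonzero polynomial in `t`, which does not vanish because `t` is
  -- transcendental.
  have hEQ : E P.primPart = 0 := by
    rw [P.eq_C_content_mul_primPart, map_mul, mul_eq_zero] at hEP
    refine hEP.resolve_left fun h => hP0 ?_
    have h' := congrArg V.subtype h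
    rw [hE, eval₂_C, map_zero] at h'
    exact content_eq_zero_iff.1 ((transcendental_iff.1 htt) _ h')
  -- The outer variable stands for `u`, the inner one for `t`, which is specialized to `0`.
  let Q := P.primPart.map (evalRingHom (0 : k))
  have hQ : Q ≠ 0 := by
    intro hQ
    have h1 : C X ∣ P.primPart := by
      rw [C_dvd_iff_dvd_coeff]
      intro i
      have := congrArg (fun r => r.coeff i) hQ
      simp only [Q, coeff_map, coe_evalRingHom, coeff_zero] at this
      rwa [X_dvd_iff, coeff_zero_eq_eval_zero]
    exact not_isUnit_X (P.isPrimitive_primPart _ h1)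
  let κ := IsLocalRing.ResidueField V
  have ht' : IsLocalRing.residue V t' = 0 := by
    rw [IsLocalRing.residue_eq_zero_iff]
    exact (V.valuation_lt_one_iff _).2 ht
  have halg : IsAlgebraic k (IsLocalRing.residue V u') := by
    refine ⟨Q, hQ, ?_⟩
    rw [← map_zero (IsLocalRing.residue V), ← hEQ]
    simp only [Q, aeval_def, eval₂_map]
    have : (eval₂RingHom ((algebraMap k κ).comp (evalRingHom 0)) (IsLocalRing.residue V u')) =
        (IsLocalRing.residue V).comp E := by
      refine Polynomial.ringHom_ext' (Polynomial.ringHom_ext' ?_ ?_) ?_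
      · ext c
        simp [E]; rfl
      · simp [E, ht']
      · simp [E]
    exact RingHom.congr_fun this _
  obtain ⟨c, hc⟩ := eq_algebraMap_of_isAlgebraic halg
  refine ⟨c, ?_⟩
  have : u' - algebraMap k V c ∈ IsLocalRing.maximalIdeal V := by
    rw [← IsLocalRing.residue_eq_zero_iff, map_sub, ← hc, sub_eq_zero]; rfl
  exact (V.valuation_lt_one_iff _).1 this

theorem residue_unique (hV : IsPlace k V) {u : L} {c c' : k}
    (h : V.valuation (u - algebraMap k L c) < 1) (h' : V.valuation (u - algebraMap k L c') < 1) :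
    c = c' := by
  by_contra hne
  have h1 : V.valuation (algebraMap k L (c - c')) < 1 := by
    have : algebraMap k L (c - c') = (u - algebraMap k L c') - (u - algebraMap k L c) := by
      rw [map_sub]; ring
    rw [this]
    exact (V.valuation.map_sub _ _).trans_lt (max_lt h' h)
  rw [hV.valuation_algebraMap (sub_ne_zero.2 hne)] at h1
  exact h1.false

/-- The maximal ideal of `W` is contained in `V`, and `W` is the sum of this ideal and `k` because
residues exist. -/
theorem eq_of_le [IsAlgClosed k] (htr : Algebra.trdeg k L ≤ 1) (hV : IsPlace k V)
    {W : ValuationSubring L} (h : V ≤ W) (hW : W ≠ ⊤) : V = W := by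
  have hW' : IsPlace k W := ⟨fun c => h (hV.1 c), hW⟩
  refine le_antisymm h fun u hu => ?_
  obtain ⟨c, hc⟩ := hW'.exists_residue htr ((W.valuation_le_one_iff _).2 hu)
  have key : ∀ z : L, W.valuation z < 1 → z ∈ V := by
    intro z hz
    by_contra hzV
    have hz0 : z ≠ 0 := by rintro rfl; exact hzV V.zero_mem
    have h1 := (W.valuation_le_one_iff _).2 (h ((V.mem_or_inv_mem z).resolve_left hzV))
    rw [map_inv₀] at h1
    exact (hz.trans_le ((inv_le_one₀ (by simp [zero_lt_iff, hz0])).1 h1)).false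
  have := V.add_mem _ _ (key _ hc) (hV.1 c)
  simpa using this

end IsPlace

end CurvePlace

end

noncomputable section

namespace CurvePlace

open Polynomial IntermediateField

variable {k L L' : Type*} [Field k] [Field L] [Algebra k L] [Field L'] [Algebra k L']
  [Algebra L L'] [IsScalarTower k L L']

/-! ### Places in a finite extension -/

theorem valuation_lt_one_iff_inv_notMem (V : ValuationSubring L) {z : L} (hz : z ≠ 0) :
    V.valuation z < 1 ↔ z⁻¹ ∉ V := by
  have := V.inv_mem_nonunits_iff (x := z⁻¹)
  rwa [inv_inv, V.mem_nonunits_iff, or_iff_right (inv_ne_zero hz)] at this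

theorem valuation_comap_le_one_iff (V : ValuationSubring L') (z : L) :
    (V.comap (algebraMap L L')).valuation z ≤ 1 ↔ V.valuation (algebraMap L L' z) ≤ 1 := by
  rw [ValuationSubring.valuation_le_one_iff, ValuationSubring.valuation_le_one_iff,
    ValuationSubring.mem_comap]

theorem valuation_comap_lt_one_iff (V : ValuationSubring L') (z : L) :
    (V.comap (algebraMap L L')).valuation z < 1 ↔ V.valuation (algebraMap L L' z) < 1 := by
  rcases eq_or_ne z 0 with rfl | hz
  · simp
  rw [valuation_lt_one_iff_inv_notMem _ hz, valuation_lt_one_iff_inv_notMem _ (by simpa using hz),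
    ValuationSubring.mem_comap, map_inv₀]

theorem mem_of_isIntegral_valuationSubring (V : ValuationSubring L) {R : Type*} [CommRing R]
    [Algebra R L] (hR : ∀ r : R, algebraMap R L r ∈ V) {z : L} (hz : IsIntegral R z) : z ∈ V := by
  have : IsIntegrallyClosedIn V L := inferInstance
  let f : R →+* V := (algebraMap R L).codRestrict V.toSubring hR
  have h : IsIntegral V z := hz.map_of_comp_eq f (RingHom.id L) (by ext; rfl)
  obtain ⟨y, rfl⟩ := IsIntegrallyClosed.algebraMap_eq_of_integral h
  exact y.2

/-- If the contraction were all of `L`, then `V` would contain every element integral over `L`, that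
is, all of `L'`. -/
theorem IsPlace.comap [Algebra.IsAlgebraic L L'] {V : ValuationSubring L'} (hV : IsPlace k V) :
    IsPlace k (V.comap (algebraMap L L')) := by
  refine ⟨fun c => ?_, fun h => hV.2 (top_le_iff.1 fun z _ => ?_)⟩
  · rw [ValuationSubring.mem_comap, ← IsScalarTower.algebraMap_apply]
    exact hV.1 c
  · refine mem_of_isIntegral_valuationSubring V (R := L) (fun r => ?_)
      (Algebra.IsAlgebraic.isAlgebraic z).isIntegral
    rw [← ValuationSubring.mem_comap, h]
    exact ValuationSubring.mem_top r

/-- `V` lies over `q`. -/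
abbrev LiesOver (V : ValuationSubring L') (q : ValuationSubring L) : Prop :=
  V.comap (algebraMap L L') = q

section

variable [IsAlgClosed k] (htr : Algebra.trdeg k L ≤ 1) {q : ValuationSubring L} (hq : IsPlace k q)
  [FiniteDimensional L L']

include htr hq

/-- An integrally closed subring is an intersection of valuation rings. Those containing `q`
contract exactly to `q`, by `IsPlace.eq_of_le`. -/
theorem isIntegral_of_forall_liesOver {b : L'}
    (hb : ∀ V : ValuationSubring L', IsPlace k V → LiesOver V q → V.valuation b ≤ 1) :
    IsIntegral q b := by
  by_contra h
  obtain ⟨V, hV, hbV⟩ := Subring.exists_le_valuationSubring_of_isIntegrallyClosedIn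
    (R := (integralClosure q L').toSubring) (x := b) h
  have hqV : ∀ z ∈ q, algebraMap L L' z ∈ V := fun z hz =>
    hV (algebraMap_mem (integralClosure q L') ⟨z, hz⟩)
  have hVk : IsPlace k V := ⟨fun c => by
    rw [IsScalarTower.algebraMap_apply k L L']; exact hqV _ (hq.1 c), by
    rintro rfl; exact hbV (ValuationSubring.mem_top b)⟩
  have h1 : q = V.comap (algebraMap L L') :=
    hq.eq_of_le htr (fun z hz => ValuationSubring.mem_comap.2 (hqV z hz)) hVk.comap.2
  exact hbV ((V.valuation_le_one_iff _).1 (hb V hVk h1.symm))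

omit htr hq [IsAlgClosed k] [Algebra k L] [Algebra k L'] [IsScalarTower k L L'] [Field k]
  [FiniteDimensional L L'] in
theorem minpoly_eq_map {b : L'} (hb : IsIntegral q b) :
    minpoly L b = (minpoly q b).map (algebraMap q L) :=
  minpoly.isIntegrallyClosed_eq_field_fractions' L hb

/-- After translating by `ρ`, the question is when the constant coefficient vanishes at `q`; up to
sign, a power of it is the norm of `c`. If `c` vanishes nowhere above `q`, both `c` and `c⁻¹` are
integral, so the norm is a unit. Conversely, the minimal equation makes this coefficient a multiple
of `c`. -/
theorem minpoly_root_iff {b : L'}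
    (hb : ∀ V : ValuationSubring L', IsPlace k V → LiesOver V q → V.valuation b ≤ 1) (ρ : k) :
    q.valuation ((minpoly L b).eval (algebraMap k L ρ)) < 1 ↔
      ∃ V : ValuationSubring L', IsPlace k V ∧ LiesOver V q ∧
        V.valuation (b - algebraMap k L' ρ) < 1 := by
  set c := b - algebraMap k L' ρ with hc
  have hcV : ∀ V : ValuationSubring L', IsPlace k V → LiesOver V q → V.valuation c ≤ 1 :=
    fun V hV hVq => (V.valuation.map_sub _ _).trans
      (max_le (hb V hV hVq) ((V.valuation_le_one_iff _).2 (hV.1 ρ)))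
  have hci := isIntegral_of_forall_liesOver htr hq hcV
  have hcoeff : (minpoly L c).coeff 0 = (minpoly L b).eval (algebraMap k L ρ) := by
    rw [hc, IsScalarTower.algebraMap_apply k L L', minpoly.sub_algebraMap, coeff_zero_eq_eval_zero]
    simp
  rw [← hcoeff]
  constructor
  · intro h
    by_contra! hcon
    -- A place above `q` excludes `c = 0` directly; were there no such place, every element would be
    -- integral over `q`, forcing `q = ⊤`.
    have hc0 : c ≠ 0 := by
      rintro h0
      by_cases hVtop : ∃ V : ValuationSubring L', IsPlace k V ∧ LiesOver V q
      · obtain ⟨V, hV, hVq⟩ := hVtop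
        have := hcon V hV hVq
        rw [h0, map_zero] at this
        exact absurd this (by simp)
      · push Not at hVtop
        refine hq.2 (top_le_iff.1 fun z _ => ?_)
        have := isIntegral_of_forall_liesOver htr hq (b := algebraMap L L' z)
          fun V hV hVq => absurd hVq (hVtop V hV)
        have := mem_of_isIntegral_valuationSubring q (R := q) (fun r => r.2)
          ((isIntegral_algebraMap_iff (algebraMap L L').injective).1 this)
        exact this
    have hinv := isIntegral_of_forall_liesOver htr hq (b := c⁻¹) fun V hV hVq => by
      rw [map_inv₀]
      exact (inv_le_one₀ (by simp [zero_lt_iff, hc0])).2 (hcon V hV hVq)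
    have h1 : q.valuation (Algebra.norm L c⁻¹) ≤ 1 := (q.valuation_le_one_iff _).2
      (mem_of_isIntegral_valuationSubring q (R := q) (fun r => r.2) (Algebra.isIntegral_norm L hinv))
    have h2 : q.valuation (Algebra.norm L c) < 1 := by
      have hcL : IsIntegral L c := Algebra.IsIntegral.isIntegral c
      have h3 := Algebra.PowerBasis.norm_gen_eq_coeff_zero_minpoly (adjoin.powerBasis hcL)
      rw [adjoin.powerBasis_gen, minpoly_gen] at h3
      rw [Algebra.norm_eq_norm_adjoin, h3, map_pow, map_mul, map_pow, Valuation.map_neg, map_one,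
        one_pow, one_mul]
      exact pow_lt_one₀ zero_le h Module.finrank_pos.ne'
    have h3 : Algebra.norm L c * Algebra.norm L c⁻¹ = 1 := by
      rw [← map_mul, mul_inv_cancel₀ hc0, map_one]
    have h4 := congrArg q.valuation h3
    rw [map_mul, map_one] at h4
    exact (mul_lt_one_of_lt_of_le h2 h1).ne h4
  · rintro ⟨V, hV, rfl, hlt⟩
    rw [valuation_comap_lt_one_iff]
    have h1 := minpoly.aeval (V.comap (algebraMap L L')) c
    rw [← divX_mul_X_add (minpoly _ c), map_add, map_mul, aeval_X, aeval_C] at h1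
    have h2 : algebraMap L L' ((minpoly L c).coeff 0) =
        -(aeval c (minpoly (V.comap (algebraMap L L')) c).divX * c) := by
      rw [minpoly_eq_map hci, coeff_map, ← IsScalarTower.algebraMap_apply]
      exact eq_neg_of_add_eq_zero_right h1
    rw [h2, Valuation.map_neg, map_mul, mul_comm]
    refine mul_lt_one_of_lt_of_le hlt ((V.valuation_le_one_iff _).2 ?_)
    exact mem_of_isIntegral_valuationSubring V (R := V.comap (algebraMap L L')) (fun r => r.2)
      (Algebra.adjoin_le (S := integralClosure _ L') (Set.singleton_subset_iff.2 hci)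
        (aeval_mem_adjoin_singleton _ _))

/-- If the residues of `b` at the places over `q` are all `0` or `c`, the trace of `b` is, at `q`,
a multiple of `c`; it is a positive multiple if the residue `c` occurs. -/
theorem exists_valuation_trace_sub_lt_one [CharZero k] {b : L'} {c : k}
    (hb : ∀ V : ValuationSubring L', IsPlace k V → LiesOver V q →
      V.valuation b < 1 ∨ V.valuation (b - algebraMap k L' c) < 1) :
    ∃ n : ℕ, q.valuation (Algebra.trace L L' b - algebraMap k L (n • c)) < 1 ∧
      ((∃ V : ValuationSubring L', IsPlace k V ∧ LiesOver V q ∧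
        V.valuation (b - algebraMap k L' c) < 1) → n ≠ 0) := by
  have hb1 : ∀ V : ValuationSubring L', IsPlace k V → LiesOver V q → V.valuation b ≤ 1 := by
    intro V hV hVq
    rcases hb V hV hVq with h | h
    · exact h.le
    · have : b = (b - algebraMap k L' c) + algebraMap k L' c := by ring
      rw [this]
      exact (V.valuation.map_add _ _).trans
        (max_le h.le ((V.valuation_le_one_iff _).2 (hV.1 c)))
  have hbi := isIntegral_of_forall_liesOver htr hq hb1
  let P := minpoly q b
  have hPm : P.Monic := minpoly.monic hbi
  have hPL : minpoly L b = P.map (algebraMap q L) := minpoly_eq_map hbi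
  let _ : Algebra k q := ((algebraMap k L).codRestrict q.toSubring hq.1).toAlgebra
  have hqL : ∀ c : k, ((algebraMap k q c : q) : L) = algebraMap k L c := fun _ => rfl
  let κ := IsLocalRing.ResidueField q
  let r : q →+* κ := IsLocalRing.residue q
  have hr0 : ∀ z : q, r z = 0 ↔ q.valuation (z : L) < 1 := fun z => by
    rw [← q.valuation_lt_one_iff, ← IsLocalRing.residue_eq_zero_iff]
  have hsurj : Function.Surjective (r.comp (algebraMap k q)) := by
    intro z
    obtain ⟨z, rfl⟩ := IsLocalRing.residue_surjective z
    obtain ⟨a, ha⟩ := hq.exists_residue htr (q.valuation_le_one z)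
    refine ⟨a, ?_⟩
    have : r (z - algebraMap k q a) = 0 := (hr0 _).2 ha
    rw [map_sub, sub_eq_zero] at this
    exact this.symm
  -- The residue field is `k`, so the reduced minimal polynomial splits; its roots are the residues
  -- of `b` above `q`, by `minpoly_root_iff`.
  have hsplit : (P.map r).Splits := by
    obtain ⟨p, hp⟩ := map_surjective _ hsurj (P.map r)
    rw [← hp]
    exact (IsAlgClosed.splits p).map _
  have hroot : ∀ ρ : k, (P.map r).IsRoot (r (algebraMap k q ρ)) ↔
      ∃ V : ValuationSubring L', IsPlace k V ∧ LiesOver V q ∧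
        V.valuation (b - algebraMap k L' ρ) < 1 := by
    intro ρ
    rw [← minpoly_root_iff htr hq hb1, hPL, IsRoot.def, Polynomial.eval_map,
      eval₂_at_apply, hr0, Polynomial.eval_map,
      show algebraMap k L ρ = algebraMap q L (algebraMap k q ρ) from rfl, eval₂_at_apply]
    rfl
  set γ := r (algebraMap k q c) with hγ
  have hroots : ∀ x ∈ (P.map r).roots, x = 0 ∨ x = γ := by
    intro x hx
    obtain ⟨ρ, rfl⟩ := hsurj x
    have hx' := (mem_roots'.1 hx).2
    obtain ⟨V, hV, hVq, hlt⟩ := (hroot ρ).1 hx'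
    rcases hb V hV hVq with h | h
    · left
      have : ρ = 0 := hV.residue_unique hlt (by simpa using h)
      simp [this]
    · right
      rw [hγ, hV.residue_unique hlt h]; rfl
  have hms : ∀ s : Multiset κ, (∀ x ∈ s, x = 0 ∨ x = γ) → ∃ n : ℕ, s.sum = n • γ ∧
      (γ ∈ s → n ≠ 0) := by
    intro s
    induction s using Multiset.induction_on with
    | empty => exact fun _ => ⟨0, by simp⟩
    | cons a s ih =>
      intro h
      obtain ⟨n, hn, -⟩ := ih fun x hx => h x (Multiset.mem_cons_of_mem hx)
      by_cases ha : a = γ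
      · exact ⟨n + 1, by rw [Multiset.sum_cons, hn, ha, succ_nsmul'], by simp⟩
      · obtain ⟨n, hn, hn'⟩ := ih fun x hx => h x (Multiset.mem_cons_of_mem hx)
        refine ⟨n, ?_, fun h' => ?_⟩
        · rw [Multiset.sum_cons, hn, (h a (Multiset.mem_cons_self _ _)).resolve_right ha, zero_add]
        · exact hn' ((Multiset.mem_cons.1 h').resolve_left (Ne.symm ha))
  obtain ⟨n, hn, hn'⟩ := hms _ hroots
  have hnext : r P.nextCoeff = -(n • γ) := by
    rw [← hn, ← hsplit.nextCoeff_eq_neg_sum_roots_of_monic (hPm.map r), nextCoeff, nextCoeff,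
      hPm.natDegree_map]
    split_ifs <;> simp
  -- The trace is `m` times the sum of the roots of the minimal polynomial, so the multiplicity `n`
  -- is scaled by `m`.
  let m := Module.finrank L⟮b⟯ L'
  have hm : m ≠ 0 := Module.finrank_pos.ne'
  refine ⟨m * n, ?_, ?_⟩
  · have h1 : Algebra.trace L L' b - algebraMap k L ((m * n) • c) =
        q.subtype (-(m • (P.nextCoeff + algebraMap k q (n • c)))) := by
      rw [trace_eq_finrank_mul_minpoly_nextCoeff, hPL,
        nextCoeff_map (FaithfulSMul.algebraMap_injective q L)]
      simp only [map_neg, map_nsmul, map_add, mul_smul]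
      rw [show q.subtype (algebraMap k q c) = algebraMap k L c from rfl,
        show q.subtype P.nextCoeff = algebraMap q L P.nextCoeff from rfl,
        nsmul_eq_mul, nsmul_eq_mul, nsmul_eq_mul]
      ring
    rw [h1, ValuationSubring.subtype_apply, ← hr0, map_neg, map_nsmul, map_add, hnext]
    simp [hγ]
  · intro h
    refine Nat.mul_ne_zero hm (hn' ?_)
    exact mem_roots'.2 ⟨(hPm.map r).ne_zero, (hroot c).2 h⟩

/-- The trace of an element that vanishes at all places over `q` vanishes at `q`. -/
theorem valuation_trace_lt_one [CharZero k] {b : L'}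
    (hb : ∀ V : ValuationSubring L', IsPlace k V → LiesOver V q → V.valuation b < 1) :
    q.valuation (Algebra.trace L L' b) < 1 := by
  obtain ⟨n, hn, -⟩ := exists_valuation_trace_sub_lt_one htr hq (c := 0)
    fun V hV hVq => Or.inl (hb V hV hVq)
  simpa using hn

/-- The trace of an element that is regular at all places over `q` is regular at `q`. -/
theorem valuation_trace_le_one {b : L'}
    (hb : ∀ V : ValuationSubring L', IsPlace k V → LiesOver V q → V.valuation b ≤ 1) :
    q.valuation (Algebra.trace L L' b) ≤ 1 :=
  (q.valuation_le_one_iff _).2 (mem_of_isIntegral_valuationSubring q (R := q) (fun r => r.2)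
    (Algebra.isIntegral_trace (isIntegral_of_forall_liesOver htr hq hb)))

end

end CurvePlace

end

noncomputable section

namespace CurvePlace

open Polynomial IntermediateField

variable {k L L' : Type*} [Field k] [Field L] [Algebra k L] [Field L'] [Algebra k L']
  [Algebra L L'] [IsScalarTower k L L']

/-! ### Differential forms with logarithmic poles -/

/-- `τ` is the element for which `dx / τ` has, up to a unit, a simple pole at `V`:
it is `x - a` if `x` has the finite value `a` at `V`, and `x` if `x` has a pole at `V`. -/
def IsLogParam (k : Type*) {L : Type*} [Field k] [Field L] [Algebra k L] (x : L)
    (V : ValuationSubring L) (τ : L) : Prop :=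
  (∃ a : k, τ = x - algebraMap k L a ∧ V.valuation τ < 1) ∨ (τ = x ∧ 1 < V.valuation x)

theorem IsLogParam.unique {x : L} {V : ValuationSubring L} (hV : IsPlace k V) {τ τ' : L}
    (h : IsLogParam k x V τ) (h' : IsLogParam k x V τ') : τ = τ' := by
  have key : ∀ a : k, V.valuation (x - algebraMap k L a) < 1 → ¬ 1 < V.valuation x := by
    intro a ha
    have : x = (x - algebraMap k L a) + algebraMap k L a := by ring
    rw [this, not_lt]
    exact (V.valuation.map_add _ _).trans (max_le ha.le ((V.valuation_le_one_iff _).2 (hV.1 a)))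
  rcases h with ⟨a, rfl, ha⟩ | ⟨rfl, h1⟩ <;> rcases h' with ⟨a', rfl, ha'⟩ | ⟨rfl, h1'⟩
  · rw [hV.residue_unique ha ha']
  · exact absurd h1' (key a ha)
  · exact absurd h1 (key a' ha')
  · rfl

theorem IsPlace.exists_isLogParam [IsAlgClosed k] (htr : Algebra.trdeg k L ≤ 1) (x : L)
    {V : ValuationSubring L} (hV : IsPlace k V) : ∃ τ, IsLogParam k x V τ := by
  by_cases h : V.valuation x ≤ 1
  · obtain ⟨a, ha⟩ := hV.exists_residue htr h
    exact ⟨_, Or.inl ⟨a, rfl, ha⟩⟩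
  · exact ⟨x, Or.inr ⟨rfl, not_le.1 h⟩⟩

theorem IsLogParam.map {x : L} {V : ValuationSubring L'} {τ : L}
    (h : IsLogParam k x (V.comap (algebraMap L L')) τ) :
    IsLogParam k (algebraMap L L' x) V (algebraMap L L' τ) := by
  rcases h with ⟨a, rfl, ha⟩ | ⟨rfl, h1⟩
  · refine Or.inl ⟨a, by rw [map_sub, ← IsScalarTower.algebraMap_apply], ?_⟩
    rwa [valuation_comap_lt_one_iff] at ha
  · refine Or.inr ⟨rfl, ?_⟩
    rwa [← not_le, valuation_comap_le_one_iff, not_le] at h1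

/-- The differential forms `h dx` with at most logarithmic poles, all of them at places in `S`. -/
def logForms (k : Type*) {L : Type*} [Field k] [Field L] [Algebra k L] (x : L)
    (S : Set (ValuationSubring L)) : Submodule k L where
  carrier := {h | ∀ V, IsPlace k V → ∀ τ, IsLogParam k x V τ →
    V.valuation (h * τ) ≤ 1 ∧ (V ∉ S → V.valuation (h * τ) < 1)}
  zero_mem' := fun V _ τ _ => by simp
  add_mem' := fun {a b} ha hb V hV τ hτ => by
    rw [add_mul]
    exact ⟨(V.valuation.map_add _ _).trans (max_le (ha V hV τ hτ).1 (hb V hV τ hτ).1),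
      fun h => (V.valuation.map_add _ _).trans_lt
        (max_lt ((ha V hV τ hτ).2 h) ((hb V hV τ hτ).2 h))⟩
  smul_mem' := fun c a ha V hV τ hτ => by
    have hc : V.valuation (algebraMap k L c) ≤ 1 := (V.valuation_le_one_iff _).2 (hV.1 c)
    rw [Algebra.smul_def, mul_assoc, map_mul]
    exact ⟨mul_le_one' hc (ha V hV τ hτ).1, fun h => by
      rw [mul_comm]; exact mul_lt_one_of_lt_of_le ((ha V hV τ hτ).2 h) hc⟩

theorem mem_logForms {x : L} {S : Set (ValuationSubring L)} {h : L} :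
    h ∈ logForms k x S ↔ ∀ V, IsPlace k V → ∀ τ, IsLogParam k x V τ →
      V.valuation (h * τ) ≤ 1 ∧ (V ∉ S → V.valuation (h * τ) < 1) := Iff.rfl

theorem mem_logForms_empty {x : L} {h : L} :
    h ∈ logForms k x ∅ ↔ ∀ V, IsPlace k V → ∀ τ, IsLogParam k x V τ →
      V.valuation (h * τ) < 1 := by
  rw [mem_logForms]
  exact forall_congr' fun V => forall_congr' fun hV => forall_congr' fun τ => forall_congr' fun hτ =>
    ⟨fun h => h.2 (Set.notMem_empty V), fun h => ⟨h.le, fun _ => h⟩⟩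

theorem logForms_mono {x : L} {S T : Set (ValuationSubring L)} (h : S ⊆ T) :
    logForms k x S ≤ logForms k x T := fun _ hg V hV τ hτ =>
  ⟨(hg V hV τ hτ).1, fun hVT => (hg V hV τ hτ).2 fun hVS => hVT (h hVS)⟩

/-- The parameter `τ` lies in `L` and stays a parameter at every place above, so `Tr(g) τ = Tr(g
τ)`, and regularity or vanishing above `q` passes to the trace. -/
theorem trace_mem_logForms [IsAlgClosed k] [CharZero k] (htr : Algebra.trdeg k L ≤ 1)
    [FiniteDimensional L L'] {x : L} {S : Set (ValuationSubring L)} {g : L'}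
    (hg : g ∈ logForms k (algebraMap L L' x) {V | V.comap (algebraMap L L') ∈ S}) :
    Algebra.trace L L' g ∈ logForms k x S := by
  intro q hq τ hτ
  have h1 : Algebra.trace L L' g * τ = Algebra.trace L L' (g * algebraMap L L' τ) := by
    rw [mul_comm, ← smul_eq_mul, ← map_smul, Algebra.smul_def, mul_comm]
  rw [h1]
  refine ⟨valuation_trace_le_one htr hq fun V hV hVq => ?_,
    fun hqS => valuation_trace_lt_one htr hq fun V hV hVq => ?_⟩
  · exact (hg V hV _ (IsLogParam.map (hVq.symm ▸ hτ))).1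
  · refine (hg V hV _ (IsLogParam.map (hVq.symm ▸ hτ))).2 fun h => hqS ?_
    rw [← hVq]; exact h

/-! ### The rational function field -/

/-- A transcendental `t` is not a unit of `k[t]`, so some valuation ring containing `k[t]` has `t`
in its maximal ideal. -/
theorem exists_isPlace_valuation_lt_one {t : L} (ht : Transcendental k t) :
    ∃ V : ValuationSubring L, IsPlace k V ∧ V.valuation t < 1 := by
  let A : Subring L := (Algebra.adjoin k {t}).toSubring
  let t' : A := ⟨t, Algebra.self_mem_adjoin_singleton k t⟩
  have hne : Ideal.span {t'} ≠ ⊤ := by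
    rw [Ne, Ideal.span_singleton_eq_top]
    intro hu
    obtain ⟨⟨s, hs⟩, hts⟩ := hu.exists_right_inv
    obtain ⟨p, rfl⟩ := Algebra.adjoin_mem_exists_aeval k t hs
    have h1 : t * aeval t p = 1 := congrArg Subtype.val hts
    have h2 : aeval t (X * p - 1) = 0 := by simp [h1]
    have h3 := (transcendental_iff.1 ht) _ h2
    have := congrArg (fun q => q.coeff 0) h3
    simp at this
  obtain ⟨V, hAV, hV⟩ := Ideal.image_subset_nonunits_valuationSubring _ hne
  have hlt : V.valuation t < 1 :=
    V.mem_nonunits_iff.1 (hV ⟨t', Ideal.subset_span rfl, rfl⟩)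
  refine ⟨V, ⟨fun c => hAV ((Algebra.adjoin k {t}).algebraMap_mem c), ?_⟩, hlt⟩
  rintro rfl
  have ht0 : t ≠ 0 := by rintro rfl; exact ht isAlgebraic_zero
  exact (valuation_lt_one_iff_inv_notMem _ ht0).1 hlt (ValuationSubring.mem_top _)

theorem IsPlace.valuation_aeval_sub_lt_one {V : ValuationSubring L} (hV : IsPlace k V) {x : L}
    {a : k} (hx : V.valuation (x - algebraMap k L a) < 1) (p : k[X]) :
    V.valuation (aeval x p - algebraMap k L (p.eval a)) < 1 := by
  have hxV : x ∈ V := by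
    have := V.add_mem _ _ ((V.valuation_le_one_iff _).1 hx.le) (hV.1 a)
    simpa using this
  obtain ⟨r, hr⟩ := X_sub_C_dvd_sub_C_eval (p := p) (a := a)
  have h1 := congrArg (aeval x) hr
  simp only [map_sub, map_mul, aeval_C, aeval_X] at h1
  clear hr
  rw [h1, map_mul]
  clear h1
  refine mul_lt_one_of_lt_of_le hx ((V.valuation_le_one_iff _).2 ?_)
  induction r using Polynomial.induction_on' with
  | add p q hp hq => rw [map_add]; exact V.add_mem _ _ hp hq
  | monomial n c => rw [aeval_monomial]; exact V.mul_mem _ _ (hV.1 c) (pow_mem hxV n)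

theorem IsPlace.one_le_valuation_aeval {V : ValuationSubring L} (hV : IsPlace k V) {x : L}
    (hx : 1 < V.valuation x) {p : k[X]} (hp : p ≠ 0) : 1 ≤ V.valuation (aeval x p) := by
  induction hn : p.natDegree generalizing p with
  | zero =>
    obtain ⟨c, rfl⟩ := natDegree_eq_zero.1 hn
    rw [aeval_C, hV.valuation_algebraMap (by simpa using hp)]
  | succ n ih =>
    have h0 : p.divX.natDegree = n := by rw [natDegree_divX_eq_natDegree_tsub_one, hn]; rfl
    have h1 : p.divX ≠ 0 := by
      intro h
      have := divX_eq_zero_iff.1 h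
      rw [this, natDegree_C] at hn
      omega
    have h2 := ih h1 h0
    rw [← divX_mul_X_add p, map_add, map_mul, aeval_X, aeval_C]
    have h3 : 1 < V.valuation (aeval x p.divX * x) := by
      rw [map_mul]
      exact hx.trans_le (le_mul_of_one_le_left zero_le h2)
    rw [Valuation.map_add_eq_of_lt_left]
    · exact h3.le
    · exact ((V.valuation_le_one_iff _).2 (hV.1 _)).trans_lt h3

/-- Write `s = P / Q` in lowest terms. Each root of `Q` is a pole of `s dx`, so it is simple and
sits at `q`; hence `deg Q ≤ 1`. Regularity of `s x` at infinity excludes `deg Q = 0`. If `deg Q =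
1`, then `q` is a finite place, so `s x` must even vanish at infinity, which is again impossible. -/
theorem logForms_singleton_eq_bot [IsAlgClosed k] {x : L} (hx : Transcendental k x)
    (htop : k⟮x⟯ = ⊤) (q : ValuationSubring L) : logForms k x {q} = ⊥ := by
  rw [eq_bot_iff]
  intro s hs
  rw [Submodule.mem_bot]
  by_contra hs0
  obtain ⟨P₀, Q₀, hPQ⟩ := (mem_adjoin_simple_iff k s).1 (htop ▸ mem_top : s ∈ k⟮x⟯)
  have hinj : ∀ p : k[X], p ≠ 0 → aeval x p ≠ 0 := fun p hp h => hp (transcendental_iff.1 hx p h)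
  have hQ₀ : Q₀ ≠ 0 := by rintro rfl; simp at hPQ; exact hs0 hPQ
  obtain ⟨P, Q, hP, hQ, hco, hsPQ⟩ : ∃ P Q : k[X], P ≠ 0 ∧ Q ≠ 0 ∧ IsCoprime P Q ∧
      s = aeval x P / aeval x Q := by
    classical
    let _ : GCDMonoid k[X] := EuclideanDomain.gcdMonoid _
    have hg : gcd P₀ Q₀ ≠ 0 := gcd_ne_zero_of_right hQ₀
    have hP := EuclideanDomain.mul_div_cancel' hg (gcd_dvd_left P₀ Q₀)
    have hQ := EuclideanDomain.mul_div_cancel' hg (gcd_dvd_right P₀ Q₀)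
    have hs' : s = aeval x (P₀ / gcd P₀ Q₀) / aeval x (Q₀ / gcd P₀ Q₀) := by
      rw [← mul_div_mul_left _ _ (hinj _ hg), ← map_mul, ← map_mul, hP, hQ, hPQ]
    refine ⟨_, _, ?_, ?_, isCoprime_div_gcd_div_gcd hQ₀, hs'⟩
    · intro h
      rw [h, map_zero, zero_div] at hs'
      exact hs0 hs'
    · intro h
      rw [h, map_zero, div_zero] at hs'
      exact hs0 hs'
  have hmem : ∀ V, IsPlace k V → ∀ b : k, V.valuation (x - algebraMap k L b) < 1 →
      Q.eval b = 0 → V = q ∧ Q.derivative.eval b ≠ 0 := by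
    intro V hV b hb hQb
    have hPb : P.eval b ≠ 0 := by
      intro hPb
      obtain ⟨u, v, huv⟩ := hco
      have := congrArg (eval b) huv
      simp [hPb, hQb] at this
    have hvP : V.valuation (aeval x P) = 1 := by
      have h1 := hV.valuation_aeval_sub_lt_one hb P
      rw [← hV.valuation_algebraMap hPb] at h1 ⊢
      exact Valuation.map_eq_of_sub_lt _ h1
    obtain ⟨R, rfl⟩ := dvd_iff_isRoot.2 hQb
    have hR : R ≠ 0 := right_ne_zero_of_mul hQ
    have hτ0 : x - algebraMap k L b ≠ 0 := by
      have := hinj (X - C b) (X_sub_C_ne_zero b)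
      simpa using this
    have h1 : s * (x - algebraMap k L b) = aeval x P / aeval x R := by
      rw [hsPQ]
      simp only [map_mul, map_sub, aeval_X, aeval_C]
      field_simp [hinj R hR]
    have h2 := hs V hV _ (Or.inl ⟨b, rfl, hb⟩)
    rw [h1, map_div₀, hvP] at h2
    have hR1 := hV.valuation_aeval_sub_lt_one hb R
    have hvR : V.valuation (aeval x R) ≤ 1 := by
      have := (V.valuation.map_add (aeval x R - algebraMap k L (R.eval b))
        (algebraMap k L (R.eval b))).trans
          (max_le hR1.le ((V.valuation_le_one_iff _).2 (hV.1 _)))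
      simpa using this
    have hvR0 : 0 < V.valuation (aeval x R) := by simp [zero_lt_iff, hinj R hR]
    refine ⟨by_contra fun hVq => ?_, fun hd => ?_⟩
    · have := h2.2 (by simpa using hVq)
      rw [div_lt_one₀ hvR0] at this
      exact (this.trans_le hvR).false
    · have hRb : R.eval b = 0 := by simpa using hd
      rw [hRb, map_zero, sub_zero] at hR1
      exact absurd ((div_le_one₀ hvR0).1 h2.1) (not_le.2 hR1)
  have hplace : ∀ b : k, ∃ V, IsPlace k V ∧ V.valuation (x - algebraMap k L b) < 1 := fun b =>
    exists_isPlace_valuation_lt_one fun h => hx (by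
      simpa using h.add (isAlgebraic_algebraMap b))
  -- `W` is the place at infinity.
  obtain ⟨W, hW, hxW⟩ := exists_isPlace_valuation_lt_one (t := x⁻¹) fun h => hx (by simpa using h.inv)
  have hx0 : x ≠ 0 := by rintro rfl; exact hx isAlgebraic_zero
  have hxW' : 1 < W.valuation x := by
    rw [map_inv₀] at hxW
    exact (inv_lt_one₀ (by simp [zero_lt_iff, hx0])).1 hxW
  have hsW := hs W hW x (Or.inr ⟨rfl, hxW'⟩)
  have hPW := hW.one_le_valuation_aeval hxW' hP
  have hvP0 : 0 < W.valuation (aeval x P) := by simp [zero_lt_iff, hinj P hP]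
  by_cases hroot : ∃ b, Q.eval b = 0
  · obtain ⟨b, hb⟩ := hroot
    obtain ⟨V, hV, hVb⟩ := hplace b
    obtain ⟨rfl, hd⟩ := hmem V hV b hVb hb
    obtain ⟨R, rfl⟩ := dvd_iff_isRoot.2 hb
    have hR : R ≠ 0 := right_ne_zero_of_mul hQ
    have hRdeg : R.degree = 0 := by
      by_contra hne
      obtain ⟨c, hc⟩ := IsAlgClosed.exists_root R hne
      obtain ⟨V', hV', hVc⟩ := hplace c
      obtain ⟨rfl, hd'⟩ := hmem V' hV' c hVc (by simp [hc.eq_zero])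
      obtain rfl := hV'.residue_unique hVb hVc
      simp [hc.eq_zero] at hd
    obtain ⟨r, rfl⟩ : ∃ r, R = C r := ⟨_, eq_C_of_degree_eq_zero hRdeg⟩
    have hr : r ≠ 0 := by rintro rfl; simp at hR
    have hWV : W ∉ ({V} : Set (ValuationSubring L)) := by
      rintro rfl
      have : x = (x - algebraMap k L b) + algebraMap k L b := by ring
      rw [this] at hxW'
      exact (hxW'.trans_le ((W.valuation.map_add _ _).trans (max_le hVb.le
        ((W.valuation_le_one_iff _).2 (hV.1 b))))).false
    have h1 := hsW.2 hWV
    have h2 : W.valuation (x - algebraMap k L b) = W.valuation x :=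
      Valuation.map_sub_eq_of_lt_left _ (((W.valuation_le_one_iff _).2 (hW.1 b)).trans_lt hxW')
    rw [hsPQ] at h1
    simp only [map_mul, map_div₀, map_sub, aeval_X, aeval_C] at h1
    rw [hW.valuation_algebraMap hr, h2, mul_one, div_mul_cancel₀ _ (by simp [hx0])] at h1
    exact (h1.trans_le hPW).false
  · have hQdeg : Q.degree = 0 := by
      by_contra hne
      obtain ⟨c, hc⟩ := IsAlgClosed.exists_root Q hne
      exact hroot ⟨c, hc⟩
    obtain ⟨r, rfl⟩ : ∃ r, Q = C r := ⟨_, eq_C_of_degree_eq_zero hQdeg⟩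
    have hr : r ≠ 0 := by rintro rfl; simp at hQ
    have h1 := hsW.1
    rw [hsPQ, aeval_C, map_mul, map_div₀, hW.valuation_algebraMap hr, div_one] at h1
    exact (hxW'.trans_le ((le_mul_of_one_le_left zero_le hPW).trans h1)).false

/-! ### Counting forms with logarithmic poles -/

section

variable [IsAlgClosed k] [CharZero k] {x : L} (hx : Transcendental k x) [FiniteDimensional k⟮x⟯ L]

include hx

/-- There is no form with exactly one logarithmic pole. -/
theorem logForms_singleton_le (p : ValuationSubring L) : logForms k x {p} ≤ logForms k x ∅ := by
  have htr : Algebra.trdeg k L ≤ 1 := trdeg_le_one_of_isAlgebraic (x := x)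
  intro h hh
  let y : k⟮x⟯ := AdjoinSimple.gen k x
  have hy : algebraMap k⟮x⟯ L y = x := rfl
  have hyt : Transcendental k y := fun h => hx (h.algebraMap (A := L))
  have hytop : k⟮y⟯ = ⊤ := by
    apply IntermediateField.map_injective k⟮x⟯.val
    rw [adjoin_map, Set.image_singleton, ← AlgHom.fieldRange_eq_map, fieldRange_val]
    rfl
  have htrF : Algebra.trdeg k k⟮x⟯ ≤ 1 := by
    have : Algebra.IsAlgebraic k⟮y⟯ k⟮x⟯ := by rw [hytop]; infer_instance
    exact trdeg_le_one_of_isAlgebraic (x := y)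
  rw [mem_logForms_empty]
  intro V hV τ hτ
  by_cases hVp : V = p
  swap
  · exact (hh V hV τ hτ).2 hVp
  subst hVp
  set q := V.comap (algebraMap k⟮x⟯ L) with hq
  have hqp : IsPlace k q := hV.comap
  -- The trace can have a pole only at the place `q` below `p`.
  have hTr : Algebra.trace k⟮x⟯ L h = 0 := by
    have h1 : Algebra.trace k⟮x⟯ L h ∈ logForms k y {q} := by
      refine trace_mem_logForms htrF (logForms_mono ?_ hh)
      rintro _ rfl
      exact hq.symm
    rwa [logForms_singleton_eq_bot hyt hytop, Submodule.mem_bot] at h1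
  obtain ⟨σ, hσ⟩ := hqp.exists_isLogParam htrF y
  have hσV : ∀ W : ValuationSubring L, LiesOver W q → IsLogParam k x W (algebraMap k⟮x⟯ L σ) :=
    fun W hW => IsLogParam.map (hW.symm ▸ hσ)
  obtain rfl := hτ.unique hV (hσV V rfl)
  obtain ⟨c, hc⟩ := hV.exists_residue htr (hh V hV _ hτ).1
  -- At the places above `q`, the residue of `h σ` is `c` at `V` and `0` elsewhere, so its trace has
  -- residue `n c` with `n ≠ 0`.
  obtain ⟨n, hn, hn0⟩ := exists_valuation_trace_sub_lt_one htrF hqp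
    (b := h * algebraMap k⟮x⟯ L σ) (c := c) fun W hW hWq => by
      by_cases hWV : W = V
      · subst hWV; exact Or.inr hc
      · exact Or.inl ((hh W hW _ (hσV W hWq)).2 hWV)
  have h1 : Algebra.trace k⟮x⟯ L (h * algebraMap k⟮x⟯ L σ) = 0 := by
    rw [mul_comm, ← Algebra.smul_def, map_smul, hTr, smul_zero]
  have h2 : n • c = 0 := by
    by_contra hne
    rw [h1, zero_sub, Valuation.map_neg, hqp.valuation_algebraMap hne] at hn
    exact hn.false
  have h3 : c = 0 := (smul_eq_zero.1 h2).resolve_left (hn0 ⟨V, hV, rfl, hc⟩)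
  simpa [h3] using hc

/-- Residues map these forms linearly to `k ^ T`, with kernel the regular forms. The image misses
the basis vector at `p`, since no form has a single simple pole; this saves one dimension. -/
theorem finrank_logForms_le (S : Finset (ValuationSubring L)) (hS : S.Nonempty)
    [Module.Finite k (logForms k x ∅)] : Module.Finite k (logForms k x S) ∧
      Module.finrank k (logForms k x S) + 1 ≤ Module.finrank k (logForms k x ∅) + S.card := by
  classical
  have htr : Algebra.trdeg k L ≤ 1 := trdeg_le_one_of_isAlgebraic (x := x)
  -- Members of `S` that are not places are irrelevant to the forms; if none are places,
  -- `S.Nonempty` still supplies the `1`.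
  let T := S.filter (IsPlace k)
  have hTS : logForms k x S = logForms k x T := by
    refine le_antisymm (fun h hh V hV τ hτ => ⟨(hh V hV τ hτ).1, fun hVT => ?_⟩)
      (logForms_mono (Finset.coe_subset.2 (Finset.filter_subset _ _)))
    exact (hh V hV τ hτ).2 fun hVS => hVT (by simpa [T] using ⟨hVS, hV⟩)
  have hT : ∀ V : T, IsPlace k V.1 := fun V => (Finset.mem_filter.1 V.2).2
  have hcard : T.card ≤ S.card := Finset.card_filter_le _ _
  rw [hTS]
  rcases T.eq_empty_or_nonempty with hT0 | ⟨p, hp⟩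
  · rw [hT0, Finset.coe_empty]
    exact ⟨inferInstance, Nat.add_le_add_left hS.card_pos _⟩
  choose τ hτ using fun V : T => (hT V).exists_isLogParam htr x
  choose c hc using fun (h : logForms k x (T : Set (ValuationSubring L))) (V : T) =>
    (hT V).exists_residue htr (h.2 V.1 (hT V) (τ V) (hτ V)).1
  let ρ : logForms k x (T : Set (ValuationSubring L)) →ₗ[k] (T → k) :=
    { toFun := c
      map_add' := fun a b => by
        funext V
        refine (hT V).residue_unique (hc _ V) ?_
        have : ((a + b : logForms k x (T : Set (ValuationSubring L))) : L) * τ V -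
            algebraMap k L ((c a + c b) V) = (a.1 * τ V - algebraMap k L (c a V)) +
              (b.1 * τ V - algebraMap k L (c b V)) := by
          rw [Pi.add_apply, map_add, Submodule.coe_add]; ring
        rw [this]
        exact (V.1.valuation.map_add _ _).trans_lt (max_lt (hc a V) (hc b V))
      map_smul' := fun r a => by
        funext V
        refine (hT V).residue_unique (hc _ V) ?_
        have : ((r • a : logForms k x (T : Set (ValuationSubring L))) : L) * τ V -
            algebraMap k L ((r • c a) V) =
              (a.1 * τ V - algebraMap k L (c a V)) * algebraMap k L r := by
          rw [Pi.smul_apply, smul_eq_mul, map_mul, Submodule.coe_smul, Algebra.smul_def]; ring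
        rw [RingHom.id_apply, this, map_mul]
        exact mul_lt_one_of_lt_of_le (hc a V) ((V.1.valuation_le_one_iff _).2 ((hT V).1 r)) }
  have hρ : ∀ h V, ρ h V = 0 → V.1.valuation (h.1 * τ V) < 1 := fun h V h0 => by
    have := hc h V
    rw [show c h V = 0 from h0, map_zero, sub_zero] at this
    exact this
  let e : LinearMap.ker ρ →ₗ[k] logForms k x ∅ :=
    ((logForms k x (T : Set (ValuationSubring L))).subtype.comp (LinearMap.ker ρ).subtype).codRestrict
      _ fun h => by
        rw [mem_logForms_empty]
        intro V hV σ hσ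
        by_cases hVT : V ∈ T
        · rw [hσ.unique hV (hτ ⟨V, hVT⟩)]
          exact hρ h.1 ⟨V, hVT⟩ (congrFun h.2 _)
        · exact (h.1.2 V hV σ hσ).2 hVT
  have he : Function.Injective e := fun a b hab =>
    Subtype.ext (Subtype.ext (congrArg Subtype.val hab : (e a).1 = (e b).1))
  have : Module.Finite k (LinearMap.ker ρ) := Module.Finite.of_injective e he
  have hker : Module.finrank k (LinearMap.ker ρ) ≤ Module.finrank k (logForms k x ∅) :=
    LinearMap.finrank_le_finrank_of_injective he
  have hfin : Module.Finite k (logForms k x (T : Set (ValuationSubring L))) := by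
    have := Module.Finite.equiv ρ.quotKerEquivRange.symm
    exact Module.Finite.of_submodule_quotient (LinearMap.ker ρ)
  have hrange : LinearMap.range ρ < ⊤ := by
    rw [lt_top_iff_ne_top]
    intro htop
    obtain ⟨h, hh⟩ := LinearMap.range_eq_top.1 htop (Pi.single ⟨p, hp⟩ 1)
    have h1 : h.1 ∈ logForms k x {p} := fun V hV σ hσ => ⟨(h.2 V hV σ hσ).1, fun hVp => by
      by_cases hVT : V ∈ T
      · rw [hσ.unique hV (hτ ⟨V, hVT⟩)]
        refine hρ h ⟨V, hVT⟩ ?_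
        rw [hh, Pi.single_eq_of_ne]
        exact fun h => hVp (congrArg Subtype.val h)
      · exact (h.2 V hV σ hσ).2 hVT⟩
    have h2 := mem_logForms_empty.1 (logForms_singleton_le hx p h1) p (hT ⟨p, hp⟩) _ (hτ ⟨p, hp⟩)
    have h3 : c h ⟨p, hp⟩ = 1 := by
      have := congrFun hh ⟨p, hp⟩
      rwa [Pi.single_eq_same] at this
    have h4 := (hT ⟨p, hp⟩).residue_unique (hc h ⟨p, hp⟩) (c' := 0) (by simpa using h2)
    exact one_ne_zero (h3.symm.trans h4)
  have h1 := Submodule.finrank_lt hrange.ne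
  rw [Module.finrank_fintype_fun_eq_card, Fintype.card_coe] at h1
  have h2 := ρ.finrank_range_add_finrank_ker
  exact ⟨hfin, by omega⟩

end

end CurvePlace

end

noncomputable section

namespace CurvePlace

open Polynomial IntermediateField

variable {k L L' : Type*} [Field k] [Field L] [Algebra k L] [Field L'] [Algebra k L']
  [Algebra L L'] [IsScalarTower k L L']

/-! ### Places and maximal ideals of Dedekind domains -/

section

variable {B : Type*} [CommRing B] [Algebra B L] (V : ValuationSubring L)
  (hB : ∀ b : B, algebraMap B L b ∈ V)

/-- The center on `B` of a valuation ring that contains `B`. -/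
def center : Ideal B :=
  (IsLocalRing.maximalIdeal V).comap ((algebraMap B L).codRestrict V.toSubring hB)

instance : (center V hB).IsPrime :=
  inferInstanceAs (((IsLocalRing.maximalIdeal V).comap _).IsPrime)

variable {V}

theorem mem_center {b : B} : b ∈ center V hB ↔ V.valuation (algebraMap B L b) < 1 :=
  V.valuation_lt_one_iff _

theorem notMem_center {b : B} : b ∉ center V hB ↔ V.valuation (algebraMap B L b) = 1 := by
  rw [mem_center, not_lt]
  exact ⟨fun h => le_antisymm ((V.valuation_le_one_iff _).2 (hB b)) h, fun h => h.ge⟩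

theorem center_ne_bot [IsDomain B] [IsFractionRing B L] (hV : V ≠ ⊤) : center V hB ≠ ⊥ := by
  intro h
  refine hV (top_le_iff.1 fun z _ => ?_)
  obtain ⟨a, s, hs, rfl⟩ := IsFractionRing.div_surjective B z
  have hs1 : V.valuation (algebraMap B L s) = 1 := by
    rw [← notMem_center hB, h, Ideal.mem_bot]
    exact nonZeroDivisors.ne_zero hs
  rw [← V.valuation_le_one_iff, map_div₀, hs1, div_one, V.valuation_le_one_iff]
  exact hB a

/-- This says that `V` is the localization of `B` at its center. That localization is a valuation
ring, so it contains `z` or `z⁻¹`; if `z⁻¹ = a / s`, then `z a = s` is a unit of `V`, so `a` avoids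
the center. -/
theorem exists_mul_eq_of_mem [IsDedekindDomain B] [IsFractionRing B L] (hV : V ≠ ⊤) {z : L}
    (hz : z ∈ V) : ∃ a s : B, s ∉ center V hB ∧ z * algebraMap B L s = algebraMap B L a := by
  let P := center V hB
  let R := Localization.subalgebra.ofField L P.primeCompl P.primeCompl_le_nonZeroDivisors
  have : IsLocalization.AtPrime R P :=
    Localization.subalgebra.isLocalization_ofField L P.primeCompl P.primeCompl_le_nonZeroDivisors
  have : IsDiscreteValuationRing R :=
    IsLocalization.AtPrime.isDiscreteValuationRing_of_dedekind_domain B (center_ne_bot hB hV) R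
  have hfrac : ∀ r : R, ∃ a s : B, s ∉ P ∧ (r : L) = algebraMap B L a * (algebraMap B L s)⁻¹ := by
    rintro ⟨r, a, s, hs, hr⟩
    exact ⟨a, s, hs, hr⟩
  have hne : ∀ s, s ∉ P → algebraMap B L s ≠ 0 := fun s hs h => by
    have := (notMem_center hB).1 hs
    rw [h, map_zero] at this
    exact zero_ne_one this
  rcases ValuationRing.isInteger_or_isInteger R z with ⟨r, hr⟩ | ⟨r, hr⟩
  · obtain ⟨a, s, hs, hras⟩ := hfrac r
    refine ⟨a, s, hs, ?_⟩
    rw [← hr, show algebraMap R L r = r from rfl, hras, inv_mul_cancel_right₀ (hne s hs)]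
  · obtain ⟨a, s, hs, hras⟩ := hfrac r
    rw [show algebraMap R L r = r from rfl, hras] at hr
    by_cases hz0 : z = 0
    · exact ⟨0, 1, P.primeCompl.one_mem, by simp [hz0]⟩
    have hz' : z * algebraMap B L a = algebraMap B L s := by
      have := congrArg (fun w => z * w * algebraMap B L s) hr
      simpa [hz0, hne s hs, mul_assoc] using this
    refine ⟨s, a, ?_, hz'⟩
    have h1 := congrArg V.valuation hz'
    rw [mul_comm, map_mul, (notMem_center hB).1 hs] at h1
    intro ha
    exact (mul_lt_one_of_lt_of_le ((mem_center hB).1 ha) ((V.valuation_le_one_iff _).2 hz)).ne h1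

theorem eq_of_center_eq [IsDedekindDomain B] [IsFractionRing B L] (hV : V ≠ ⊤)
    {W : ValuationSubring L} (hBW : ∀ b : B, algebraMap B L b ∈ W) (hW : W ≠ ⊤)
    (h : center V hB = center W hBW) : V = W := by
  have key : ∀ {V W : ValuationSubring L} (hB : ∀ b : B, algebraMap B L b ∈ V) (_ : V ≠ ⊤)
    (hBW : ∀ b : B, algebraMap B L b ∈ W) (_ : center V hB = center W hBW), V ≤ W := by
    intro V W hB hV hBW h z hz
    obtain ⟨a, s, hs, has⟩ := exists_mul_eq_of_mem hB hV hz
    rw [h, notMem_center] at hs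
    have h1 := congrArg W.valuation has
    rw [map_mul, hs, mul_one] at h1
    rw [← W.valuation_le_one_iff, h1, W.valuation_le_one_iff]
    exact hBW a
  exact le_antisymm (key hB hV hBW h) (key hBW hW hB h.symm)

end

section

variable {A B : Type*} [CommRing A] [IsDedekindDomain A] [CharZero A] [CommRing B]
  [IsDedekindDomain B] [Algebra A B] [Module.Finite A B] [Module.IsTorsionFree A B]
  [Algebra B L] [IsFractionRing B L]

-- Such a `V` is determined by its center, and the number of primes over `p` is at most `∑ e f`,
-- which is the rank.
variable (A B L) in
omit [CharZero A] in
theorem exists_finset_of_liesOver (p : Ideal A) [p.IsPrime] :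
    ∃ S : Finset (ValuationSubring L), S.card ≤ Module.finrank A B ∧
      ∀ V, V ≠ ⊤ → ∀ hB : ∀ b : B, algebraMap B L b ∈ V, (center V hB).LiesOver p → V ∈ S := by
  classical
  have : Fintype (p.primesOver B) := (Algebra.QuasiFinite.finite_primesOver p).fintype
  have hsum := Ideal.sum_ramification_inertia_eq_finrank p B
  have hcard : Fintype.card (p.primesOver B) ≤ Module.finrank A B := by
    rw [← hsum, ← Finset.card_univ, Finset.card_eq_sum_ones]
    exact Finset.sum_le_sum fun P _ => Nat.mul_pos (P.1.ramificationIdx_pos A) (P.1.inertiaDeg_pos A)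
  let T : Set (ValuationSubring L) := {V | V ≠ ⊤ ∧ ∃ hB : ∀ b : B, algebraMap B L b ∈ V,
    (center V hB).LiesOver p}
  let f : T → p.primesOver B := fun V => ⟨center V.1 V.2.2.choose, inferInstance, V.2.2.choose_spec⟩
  have hf : Function.Injective f := fun V W h =>
    Subtype.ext (eq_of_center_eq V.2.2.choose V.2.1 W.2.2.choose W.2.1 (congrArg Subtype.val h))
  have : Finite T := Finite.of_injective f hf
  have := Fintype.ofFinite T
  refine ⟨T.toFinset, ?_, fun V hV hB hp => Set.mem_toFinset.2 ⟨hV, hB, hp⟩⟩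
  rw [Set.toFinset_card]
  exact (Fintype.card_le_of_injective f hf).trans hcard

-- Ramified primes divide the different, which is nonzero in characteristic zero.
variable (A B) in
theorem exists_finite_ramified_primes : ∃ T : Set (Ideal B), T.Finite ∧ (∀ P ∈ T, P.IsPrime) ∧
    ∀ (P : Ideal B) [P.IsPrime], P ≠ ⊥ → P ∉ T → Algebra.IsUnramifiedAt A P := by
  have : FaithfulSMul A B := inferInstance
  let _ := FractionRing.liftAlgebra A (FractionRing B)
  have := FractionRing.isScalarTower_liftAlgebra A (FractionRing B)
  have : CharZero (FractionRing A) :=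
    charZero_of_injective_algebraMap (FaithfulSMul.algebraMap_injective A _)
  have : Algebra.IsAlgebraic (FractionRing A) (FractionRing B) := inferInstance
  have hdiff : differentIdeal A B ≠ ⊥ := differentIdeal_ne_bot
  refine ⟨(fun v => v.asIdeal) '' {v : IsDedekindDomain.HeightOneSpectrum B |
    v.asIdeal ∣ differentIdeal A B}, (Ideal.finite_factors hdiff).image _, ?_, ?_⟩
  · rintro _ ⟨v, -, rfl⟩
    exact v.isPrime
  · intro P hP hP0 hPT
    rw [← not_dvd_differentIdeal_iff]
    exact fun h => hPT ⟨⟨P, hP, hP0⟩, h, rfl⟩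

-- Without ramification, `π` generates the maximal ideal of the localization of `B` at the center,
-- so it divides `z` there.
omit [CharZero A] in
theorem valuation_div_le_one_of_isUnramifiedAt {V : ValuationSubring L} (hV : V ≠ ⊤)
    (hB : ∀ b : B, algebraMap B L b ∈ V) (hunr : Algebra.IsUnramifiedAt A (center V hB)) {π : A}
    (hπ0 : π ≠ 0) [(Ideal.span {π}).IsPrime] [(center V hB).LiesOver (Ideal.span {π})] {z : L}
    (hz : V.valuation z < 1) : V.valuation (z / algebraMap B L (algebraMap A B π)) ≤ 1 := by
  set P := center V hB with hP
  let _ := Localization.AtPrime.algebraOfLiesOver (Ideal.span {π}) P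
  have hmap := ((Algebra.isUnramifiedAt_iff_map_eq A (Ideal.span {π}) P).1 hunr).2
  obtain ⟨a, s, hs, has⟩ := exists_mul_eq_of_mem hB hV ((V.valuation_le_one_iff _).1 hz.le)
  have haP : a ∈ P := by
    rw [hP, mem_center, ← has, map_mul, (notMem_center hB).1 hs, mul_one]
    exact hz
  have h1 : algebraMap B (Localization.AtPrime P) a ∈
      IsLocalRing.maximalIdeal (Localization.AtPrime P) :=
    (IsLocalization.AtPrime.to_map_mem_maximal_iff _ P a).2 haP
  rw [← hmap, Ideal.map_span, Set.image_singleton, Ideal.mem_span_singleton] at h1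
  obtain ⟨w, hw⟩ := h1
  obtain ⟨b, t, rfl⟩ := IsLocalization.exists_mk'_eq P.primeCompl w
  rw [IsScalarTower.algebraMap_apply A B] at hw
  have h2 : a * t = algebraMap A B π * b := by
    apply IsLocalization.injective (Localization.AtPrime P) P.primeCompl_le_nonZeroDivisors
    rw [map_mul, hw, mul_assoc, IsLocalization.mk'_spec, map_mul]
  have h3 := congrArg V.valuation (congrArg (algebraMap B L) h2)
  have h4 := congrArg V.valuation has
  have ht : V.valuation (algebraMap B L t) = 1 := (notMem_center hB).1 t.2
  rw [map_mul, map_mul, map_mul, map_mul, ht, mul_one] at h3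
  rw [map_mul, (notMem_center hB).1 hs, mul_one] at h4
  have hπL : algebraMap B L (algebraMap A B π) ≠ 0 := by
    rw [Ne, FaithfulSMul.algebraMap_eq_zero_iff, FaithfulSMul.algebraMap_eq_zero_iff]
    exact hπ0
  rw [map_div₀, h4, h3, mul_div_cancel_left₀ _ (by simpa using hπL), V.valuation_le_one_iff]
  exact hB b

end

/-! ### Zeros of `y - c` for almost all constants `c`. -/

section

variable (k) (y : L)

open scoped algebraAdjoinAdjoin

theorem isPrincipalIdealRing_algebraAdjoin : IsPrincipalIdealRing (Algebra.adjoin k {y}) := by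
  let φ : k[X] →ₐ[k] Algebra.adjoin k {y} :=
    aeval (⟨y, Algebra.self_mem_adjoin_singleton k y⟩ : Algebra.adjoin k {y})
  have hφ' : (Algebra.adjoin k {y}).val.comp φ = aeval y := by ext; simp [φ]
  refine IsPrincipalIdealRing.of_surjective φ.toRingHom ?_
  rintro ⟨z, hz⟩
  obtain ⟨q, rfl⟩ := Algebra.adjoin_mem_exists_aeval k y hz
  exact ⟨q, Subtype.ext (DFunLike.congr_fun hφ' q)⟩

variable [CharZero k] [FiniteDimensional k⟮y⟯ L]

theorem isDedekindDomain_integralClosure :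
    IsDedekindDomain (integralClosure (Algebra.adjoin k {y}) L) := by
  have := isPrincipalIdealRing_algebraAdjoin k y
  have : CharZero k⟮y⟯ := charZero_of_injective_algebraMap (algebraMap k k⟮y⟯).injective
  exact integralClosure.isDedekindDomain (Algebra.adjoin k {y}) k⟮y⟯ L

theorem finite_integralClosure :
    Module.Finite (Algebra.adjoin k {y}) (integralClosure (Algebra.adjoin k {y}) L) := by
  have := isPrincipalIdealRing_algebraAdjoin k y
  have : CharZero k⟮y⟯ := charZero_of_injective_algebraMap (algebraMap k k⟮y⟯).injective
  exact IsIntegralClosure.finite (Algebra.adjoin k {y}) k⟮y⟯ L _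

instance isFractionRing_integralClosure :
    IsFractionRing (integralClosure (Algebra.adjoin k {y}) L) L :=
  integralClosure.isFractionRing_of_finite_extension k⟮y⟯ L

variable {k y}

omit [CharZero k] [FiniteDimensional k⟮y⟯ L] in
theorem IsPlace.algebraMap_integralClosure_mem {V : ValuationSubring L} (hV : IsPlace k V)
    (hyV : y ∈ V) (b : integralClosure (Algebra.adjoin k {y}) L) :
    algebraMap (integralClosure (Algebra.adjoin k {y}) L) L b ∈ V := by
  refine mem_of_isIntegral_valuationSubring V (R := Algebra.adjoin k {y}) ?_ b.2
  rintro ⟨r, hr⟩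
  let V' : Subalgebra k L := { V.toSubring with algebraMap_mem' := hV.1 }
  exact (Algebra.adjoin_le (S := V') (Set.singleton_subset_iff.2 hyV)) hr

omit [CharZero k] [FiniteDimensional k⟮y⟯ L] in
theorem IsPlace.mem_of_valuation_sub_lt_one {V : ValuationSubring L} (hV : IsPlace k V) {c : k}
    (h : V.valuation (y - algebraMap k L c) < 1) : y ∈ V := by
  have := V.add_mem _ _ ((V.valuation_le_one_iff _).1 h.le) (hV.1 c)
  simpa using this

set_option maxHeartbeats 800000 in
/-- Apart from finitely many values `c`, the function `y - c` has at most `[L : k(y)]` zeros, and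
all of them are simple. -/
theorem exists_finite_ramified_values (hy : Transcendental k y) : ∃ bad : Set k, bad.Finite ∧ ∀ c ∉ bad,
    (∃ S : Finset (ValuationSubring L), S.card ≤ Module.finrank k⟮y⟯ L ∧
      ∀ V, IsPlace k V → V.valuation (y - algebraMap k L c) < 1 → V ∈ S) ∧
    ∀ V, IsPlace k V → V.valuation (y - algebraMap k L c) < 1 →
      ∀ z, V.valuation z < 1 → V.valuation (z / (y - algebraMap k L c)) ≤ 1 := by
  have := isPrincipalIdealRing_algebraAdjoin k y
  have := isDedekindDomain_integralClosure k y
  have := finite_integralClosure k y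
  have : CharZero k⟮y⟯ := charZero_of_injective_algebraMap (algebraMap k k⟮y⟯).injective
  let A := Algebra.adjoin k {y}
  let B := integralClosure A L
  have hinj : Function.Injective (algebraMap A B) := fun a b hab =>
    Subtype.ext (congrArg (fun z : B => (z : L)) hab)
  have : FaithfulSMul A B := (faithfulSMul_iff_algebraMap_injective A B).2 hinj
  have : Module.IsTorsionFree A B := inferInstance
  have hBV : ∀ V : ValuationSubring L, IsPlace k V → ∀ c : k,
      V.valuation (y - algebraMap k L c) < 1 → ∀ b : B, algebraMap B L b ∈ V := fun V hV c hc =>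
    hV.algebraMap_integralClosure_mem (hV.mem_of_valuation_sub_lt_one hc)
  let y' : A := ⟨y, Algebra.self_mem_adjoin_singleton k y⟩
  let π : k → A := fun c => y' - algebraMap k A c
  have hyB : ∀ c : k, algebraMap B L (algebraMap A B (π c)) = y - algebraMap k L c := fun c => rfl
  have hπ0 : ∀ c : k, y - algebraMap k L c ≠ 0 := fun c h => hy (by
    rw [sub_eq_zero] at h; rw [h]; exact isAlgebraic_algebraMap c)
  have := isPrincipalIdealRing_algebraAdjoin k y
  -- Properness comes from a place where `y` takes the value `c`; maximality holds because an
  -- element outside the ideal is congruent to a nonzero constant.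
  have hmax : ∀ c : k, (Ideal.span {π c}).IsMaximal := by
    intro c
    rw [Ideal.isMaximal_iff]
    refine ⟨fun h1 => ?_, fun J a hJ ha haJ => ?_⟩
    · obtain ⟨V, hV, hVc⟩ := exists_isPlace_valuation_lt_one (t := y - algebraMap k L c)
        fun h => hy (by simpa using h.add (isAlgebraic_algebraMap c))
      have h2 : V.valuation (algebraMap B L (algebraMap A B 1)) < 1 := by
        have : algebraMap A B 1 ∈ center V (hBV V hV c hVc) :=
          (Ideal.span_singleton_le_iff_mem (I := (center V (hBV V hV c hVc)).under A)).2
            ((mem_center (hBV V hV c hVc)).2 hVc) h1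
        exact (mem_center _).1 this
      simp at h2
    · obtain ⟨p, hp⟩ : ∃ p : k[X], a = aeval y' p := by
        obtain ⟨p, hp⟩ := Algebra.adjoin_mem_exists_aeval k y a.2
        exact ⟨p, Subtype.ext (by
          rw [← hp, ← Subalgebra.coe_val, ← aeval_algHom_apply]; rfl)⟩
      obtain ⟨r, hr⟩ := X_sub_C_dvd_sub_C_eval (p := p) (a := c)
      have h1 := congrArg (aeval y') hr
      simp only [map_sub, map_mul, aeval_C, aeval_X, ← hp] at h1
      have hπJ : π c ∈ J := hJ (Ideal.mem_span_singleton_self _)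
      have hne : p.eval c ≠ 0 := fun h0 => ha (by
        rw [h0, map_zero, sub_zero] at h1
        exact Ideal.mem_span_singleton'.2 ⟨aeval y' r, by rw [h1, mul_comm]⟩)
      have h2 : algebraMap k A (p.eval c) ∈ J := by
        have : algebraMap k A (p.eval c) = a - π c * aeval y' r := by rw [← h1]; ring
        rw [this]
        exact J.sub_mem haJ (J.mul_mem_right _ hπJ)
      have h3 := J.mul_mem_left (algebraMap k A (p.eval c)⁻¹) h2
      rwa [← map_mul, inv_mul_cancel₀ hne, map_one] at h3
  have : CharZero A := charZero_of_injective_algebraMap (algebraMap k A).injective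
  obtain ⟨T, hTfin, hTp, hT⟩ := exists_finite_ramified_primes A B
  have hover : ∀ c V (hV : IsPlace k V) (hVc : V.valuation (y - algebraMap k L c) < 1),
      (center V (hBV V hV c hVc)).LiesOver (Ideal.span {π c}) := by
    intro c V hV hVc
    have hle : Ideal.span {π c} ≤ (center V (hBV V hV c hVc)).under A := by
      rw [Ideal.span_singleton_le_iff_mem]
      exact (mem_center (hBV V hV c hVc)).2 hVc
    exact ⟨(hmax c).eq_of_le (Ideal.IsPrime.ne_top inferInstance) hle⟩
  -- A ramified prime contains `y - c` for at most one `c`, because two such elements differ by a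
  -- nonzero constant.
  refine ⟨⋃ P ∈ T, {c | algebraMap A B (π c) ∈ P}, hTfin.biUnion fun P hP =>
    Set.Subsingleton.finite ?_, fun c hc => ⟨?_, ?_⟩⟩
  · intro c hc c' hc'
    by_contra hne
    have h1 := P.sub_mem hc hc'
    have h2 : algebraMap A B (π c) - algebraMap A B (π c') =
        algebraMap A B (algebraMap k A (c' - c)) := by
      rw [← map_sub, map_sub (algebraMap k A)]
      congr 1
      simp only [π]
      ring
    rw [h2] at h1
    refine (hTp P hP).ne_top ((Ideal.eq_top_iff_one P).2 ?_)
    have h3 := P.mul_mem_left (algebraMap A B (algebraMap k A (c' - c)⁻¹)) h1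
    rwa [← map_mul, ← map_mul, inv_mul_cancel₀ (sub_ne_zero.2 (Ne.symm hne)), map_one,
      map_one] at h3
  · have := (hmax c).isPrime
    obtain ⟨S, hS, hS'⟩ := exists_finset_of_liesOver L A B (Ideal.span {π c})
    refine ⟨S, hS.trans_eq ?_, fun V hV hVc => hS' V hV.2 (hBV V hV c hVc) (hover c V hV hVc)⟩
    exact (IsFractionRing.finrank_eq A k⟮y⟯ B L).symm
  · intro V hV hVc z hz
    have := (hmax c).isPrime
    have := hover c V hV hVc
    refine valuation_div_le_one_of_isUnramifiedAt hV.2 (hBV V hV c hVc) (hT _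
      (center_ne_bot _ hV.2) fun h => hc ?_) (π := π c) ?_ hz
    · exact Set.mem_biUnion h ((mem_center (hBV V hV c hVc)).2 hVc)
    · exact fun h => hπ0 c (congrArg Subtype.val h)

end

end CurvePlace

end

noncomputable section

namespace CurvePlace

open Polynomial IntermediateField

variable {k L L' : Type*} [Field k] [Field L] [Algebra k L] [Field L'] [Algebra k L']
  [Algebra L L'] [IsScalarTower k L L']

/-! ### The inequality of Castelnuovo and Severi -/

/-- Clearing denominators gives a polynomial of degree at most `N` that kills `y`, whose minimal
polynomial has degree `N + 1`. It is therefore zero, and evaluating it at `cⱼ` isolates `sⱼ`. -/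
theorem partial_fractions_eq_zero [FiniteDimensional L L'] {y : L'} (hy : Transcendental k y)
    (hytop : L⟮y⟯ = ⊤) {N : ℕ} (hN : N + 1 = Module.finrank L L') {c : Fin N → k}
    (hc : Function.Injective c) {r : L} {s : Fin N → L} (h0 : algebraMap L L' r +
      ∑ j, algebraMap L L' (s j) * (y - algebraMap k L' (c j))⁻¹ = 0) : r = 0 ∧ s = 0 := by
  have hc0 : ∀ j, y - algebraMap k L' (c j) ≠ 0 := fun j h => hy (by
    rw [sub_eq_zero] at h; rw [h]; exact isAlgebraic_algebraMap _)
  let a : Fin N → L := fun j => algebraMap k L (c j)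
  have ha : Function.Injective a := (algebraMap k L).injective.comp hc
  let D : L[X] := ∏ j, (X - C (a j))
  let E : Fin N → L[X] := fun j => ∏ i ∈ Finset.univ.erase j, (X - C (a i))
  have hDE : ∀ j, (X - C (a j)) * E j = D := fun j =>
    Finset.mul_prod_erase Finset.univ (fun i => X - C (a i)) (Finset.mem_univ j)
  have hya : ∀ j, aeval y (X - C (a j)) = y - algebraMap k L' (c j) := fun j => by
    simp [a, ← IsScalarTower.algebraMap_apply]
  let G : L[X] := C r * D + ∑ j, C (s j) * E j
  have hG : aeval y G = 0 := by
    have : aeval y G = aeval y D * (algebraMap L L' r +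
        ∑ j, algebraMap L L' (s j) * (y - algebraMap k L' (c j))⁻¹) := by
      simp only [G, map_add, map_mul, map_sum, aeval_C, mul_add, Finset.mul_sum]
      congr 1
      · ring
      · refine Finset.sum_congr rfl fun j _ => ?_
        rw [← hDE j, map_mul, hya]
        field_simp [hc0 j]
    rw [this, h0, mul_zero]
  have hDdeg : D.natDegree = N := by
    simp [D, natDegree_prod_of_monic _ _ fun j _ => monic_X_sub_C (a j)]
  have hEdeg : ∀ j, (E j).natDegree ≤ N := fun j => by
    have hE : (E j).Monic := monic_prod_of_monic _ _ fun i _ => monic_X_sub_C (a i)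
    rw [← hDdeg, ← hDE j, (monic_X_sub_C (a j)).natDegree_mul hE]
    exact Nat.le_add_left _ _
  have hGdeg : G.natDegree ≤ N := by
    have h1 : (C r * D).natDegree ≤ N := (natDegree_C_mul_le r D).trans hDdeg.le
    have h2 : (∑ j, C (s j) * E j).natDegree ≤ N :=
      natDegree_sum_le_of_forall_le _ _ fun j _ => (natDegree_C_mul_le (s j) (E j)).trans (hEdeg j)
    exact natDegree_add_le_of_degree_le h1 h2
  have hmin : (minpoly L y).natDegree = N + 1 := by
    rw [← adjoin.finrank (Algebra.IsIntegral.isIntegral y), hytop, finrank_top', hN]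
  have hG0 : G = 0 := by
    by_contra hne
    have := natDegree_le_natDegree (minpoly.degree_le_of_ne_zero L y hne hG)
    omega
  have hs : ∀ j, s j = 0 := by
    intro j
    have h1 := congrArg (eval (a j)) hG0
    have hD0 : eval (a j) D = 0 := by simp [← hDE j]
    have hE0 : ∀ i, i ≠ j → eval (a j) (E i) = 0 := fun i hij => by
      simp only [E, eval_prod]
      exact Finset.prod_eq_zero (Finset.mem_erase.2 ⟨hij.symm, Finset.mem_univ j⟩) (by simp)
    have hE1 : eval (a j) (E j) ≠ 0 := by
      simp only [E, eval_prod]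
      refine Finset.prod_ne_zero_iff.2 fun i hi => ?_
      simpa [sub_eq_zero] using fun h => (Finset.mem_erase.1 hi).1 (ha h).symm
    simp only [G, eval_add, eval_mul, eval_C, hD0, mul_zero, zero_add, eval_finsetSum,
      eval_zero] at h1
    rw [Finset.sum_eq_single j (fun i _ hij => by rw [hE0 i hij, mul_zero]) (by simp)] at h1
    exact (mul_eq_zero.1 h1).resolve_right hE1
  have hr : r = 0 := by simpa [hs] using h0
  exact ⟨hr, funext hs⟩

/-- Partial fractions: if `y` generates `L'` over `L` and `c₁, …, c_N` are distinct constants with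
`N + 1 = [L' : L]`, then `1, 1 / (y - c₁), …, 1 / (y - c_N)` span `L'` over `L`. -/
theorem exists_partial_fractions [FiniteDimensional L L'] {y : L'} (hy : Transcendental k y)
    (hytop : L⟮y⟯ = ⊤) {N : ℕ} (hN : N + 1 = Module.finrank L L') {c : Fin N → k}
    (hc : Function.Injective c) (z : L') :
    ∃ (r : L) (s : Fin N → L), z = algebraMap L L' r +
      ∑ j, algebraMap L L' (s j) * (y - algebraMap k L' (c j))⁻¹ := by
  let Ψ : (L × (Fin N → L)) →ₗ[L] L' :=
    (Algebra.linearMap L L').coprod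
      (∑ j, ((LinearMap.mulRight L (y - algebraMap k L' (c j))⁻¹).comp
        (Algebra.linearMap L L')).comp (LinearMap.proj j))
  have hΨ : ∀ r s, Ψ (r, s) = algebraMap L L' r +
      ∑ j, algebraMap L L' (s j) * (y - algebraMap k L' (c j))⁻¹ := fun r s => by
    simp [Ψ, LinearMap.sum_apply]
  have hinj : Function.Injective Ψ := by
    rw [← LinearMap.ker_eq_bot, LinearMap.ker_eq_bot']
    rintro ⟨r, s⟩ h0
    rw [hΨ] at h0
    obtain ⟨rfl, rfl⟩ := partial_fractions_eq_zero hy hytop hN hc h0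
    rfl
  have hsurj : Function.Surjective Ψ := by
    rw [← LinearMap.injective_iff_surjective_of_finrank_eq_finrank]
    · exact hinj
    · rw [Module.finrank_prod, Module.finrank_self, Module.finrank_fin_fun, ← hN, add_comm]
  obtain ⟨⟨r, s⟩, rfl⟩ := hsurj z
  exact ⟨r, s, hΨ r s⟩

section

variable [IsAlgClosed k] [CharZero k]

theorem finrank_logForms_le_of_card_le {x : L} (hx : Transcendental k x)
    [FiniteDimensional k⟮x⟯ L] {m : ℕ} (hm : 0 < m) (S : Finset (ValuationSubring L))
    (hS : S.card ≤ m) [Module.Finite k (logForms k x ∅)] : Module.Finite k (logForms k x S) ∧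
      Module.finrank k (logForms k x S) + 1 ≤ Module.finrank k (logForms k x ∅) + m := by
  rcases S.eq_empty_or_nonempty with rfl | hne
  · rw [Finset.coe_empty]
    exact ⟨inferInstance, Nat.add_le_add_left hm _⟩
  · obtain ⟨h1, h2⟩ := finrank_logForms_le hx S hne
    exact ⟨h1, h2.trans (Nat.add_le_add_left hS _)⟩

/-- **Castelnuovo–Severi**: if `L' = L(y)`, the genus of `L'` is at most
`[L' : L] g + ([L' : L] - 1) ([L' : k(y)] - 1)` where `g` is the genus of `L`. -/
theorem finrank_logForms_le_of_adjoin_simple_eq_top [FiniteDimensional L L'] {x : L}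
    (hx : Transcendental k x) [FiniteDimensional k⟮x⟯ L] {y : L'} (hy : Transcendental k y)
    [FiniteDimensional k⟮y⟯ L'] (hytop : L⟮y⟯ = ⊤) {N : ℕ} (hN : N + 1 = Module.finrank L L')
    [Module.Finite k (logForms k x ∅)] :
    Module.Finite k (logForms k (algebraMap L L' x) ∅) ∧
      Module.finrank k (logForms k (algebraMap L L' x) ∅) + N ≤
        (N + 1) * Module.finrank k (logForms k x ∅) + N * Module.finrank k⟮y⟯ L' := by
  classical
  have htr : Algebra.trdeg k L ≤ 1 := trdeg_le_one_of_isAlgebraic (x := x)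
  have : CharZero L := charZero_of_injective_algebraMap (algebraMap k L).injective
  obtain ⟨bad, hbad, hgood⟩ := exists_finite_ramified_values (k := k) hy
  have : Infinite ↥(badᶜ) := hbad.infinite_compl.to_subtype
  let c : Fin N → k := fun j => (Infinite.natEmbedding ↥(badᶜ) j : k)
  have hcinj : Function.Injective c := fun i j h =>
    Fin.ext ((Infinite.natEmbedding ↥(badᶜ)).injective (Subtype.ext h))
  have hcbad : ∀ j, c j ∉ bad := fun j => (Infinite.natEmbedding ↥(badᶜ) j).2
  have hc0 : ∀ j, y - algebraMap k L' (c j) ≠ 0 := fun j h => hy (by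
    rw [sub_eq_zero] at h; rw [h]; exact isAlgebraic_algebraMap _)
  choose S hScard hS using fun j => (hgood (c j) (hcbad j)).1
  -- Only the places below zeros of `y - cⱼ` can be poles of the `j`-th trace; simplicity of the
  -- zeros keeps these poles logarithmic.
  let T : Fin N → Finset (ValuationSubring L) :=
    fun j => (S j).image fun V => V.comap (algebraMap L L')
  have hT : ∀ j, (T j).card ≤ Module.finrank k⟮y⟯ L' := fun j =>
    Finset.card_image_le.trans (hScard j)
  have hdim := fun j => finrank_logForms_le_of_card_le hx Module.finrank_pos (T j) (hT j)
  have htrace : ∀ h ∈ logForms k (algebraMap L L' x) ∅,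
      Algebra.trace L L' h ∈ logForms k x ∅ := fun h hh =>
    trace_mem_logForms htr (logForms_mono (Set.empty_subset _) hh)
  have htrace' : ∀ j, ∀ h ∈ logForms k (algebraMap L L' x) ∅,
      Algebra.trace L L' (h * (y - algebraMap k L' (c j))⁻¹) ∈ logForms k x (T j) := by
    intro j h hh
    refine trace_mem_logForms htr fun V hV τ hτ => ?_
    have h1 := mem_logForms_empty.1 hh V hV τ hτ
    have h2 : h * (y - algebraMap k L' (c j))⁻¹ * τ = h * τ / (y - algebraMap k L' (c j)) := by
      rw [div_eq_mul_inv]; ring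
    rw [h2]
    by_cases hlt : V.valuation (y - algebraMap k L' (c j)) < 1
    · refine ⟨(hgood (c j) (hcbad j)).2 V hV hlt _ h1, fun hVT => absurd ?_ hVT⟩
      exact Finset.mem_coe.2 (Finset.mem_image_of_mem _ (hS j V hV hlt))
    · have h3 : V.valuation (h * τ / (y - algebraMap k L' (c j))) < 1 := by
        rw [map_div₀]
        refine (div_lt_one₀ (by simp [zero_lt_iff, hc0])).2 (h1.trans_le (not_lt.1 hlt))
      exact ⟨h3.le, fun _ => h3⟩
  have := fun j => (hdim j).1
  let Tr : L' →ₗ[k] L := (Algebra.trace L L').restrictScalars k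
  let Φ₀ : logForms k (algebraMap L L' x) ∅ →ₗ[k] logForms k x ∅ :=
    (Tr.comp (Submodule.subtype _)).codRestrict _ fun h => htrace h.1 h.2
  let Φ₁ : ∀ j, logForms k (algebraMap L L' x) ∅ →ₗ[k] logForms k x (T j) := fun j =>
    ((Tr.comp (LinearMap.mulRight k (y - algebraMap k L' (c j))⁻¹)).comp
      (Submodule.subtype _)).codRestrict _ fun h => htrace' j h.1 h.2
  let Φ := Φ₀.prod (LinearMap.pi Φ₁)
  -- An element of the kernel is trace-orthogonal to `1` and to the `1 / (y - cⱼ)`, which span `L'`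
  -- over `L`.
  have hΦ : Function.Injective Φ := by
    rw [← LinearMap.ker_eq_bot, LinearMap.ker_eq_bot']
    intro h h0
    have e0 : Algebra.trace L L' h.1 = 0 := congrArg (fun w => (w.1 : L)) h0
    have e1 : ∀ j, Algebra.trace L L' (h.1 * (y - algebraMap k L' (c j))⁻¹) = 0 := fun j =>
      congrArg (fun w => (w.2 j : L)) h0
    have e2 : ∀ z, Algebra.traceForm L L' h.1 z = 0 := by
      intro z
      obtain ⟨r, s, rfl⟩ := exists_partial_fractions hy hytop hN hcinj z
      have hL : ∀ (r : L) (w : L'), Algebra.trace L L' (h.1 * (algebraMap L L' r * w)) =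
          r * Algebra.trace L L' (h.1 * w) := fun r w => by
        rw [mul_left_comm, ← Algebra.smul_def, map_smul, smul_eq_mul]
      rw [Algebra.traceForm_apply, mul_add, map_add, Finset.mul_sum, map_sum]
      have := hL r 1
      rw [mul_one, mul_one, e0, mul_zero] at this
      rw [this, zero_add]
      exact Finset.sum_eq_zero fun j _ => by rw [hL, e1, mul_zero]
    exact Subtype.ext ((traceForm_nondegenerate L L').1 h.1 e2)
  refine ⟨Module.Finite.of_injective Φ hΦ, ?_⟩
  have h1 := LinearMap.finrank_le_finrank_of_injective hΦ
  rw [Module.finrank_prod, Module.finrank_pi_fintype] at h1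
  have h2 : ∑ j, (Module.finrank k (logForms k x (T j : Set (ValuationSubring L))) + 1) ≤
      ∑ _j : Fin N, (Module.finrank k (logForms k x ∅) + Module.finrank k⟮y⟯ L') :=
    Finset.sum_le_sum fun j _ => (hdim j).2
  rw [Finset.sum_add_distrib] at h2
  simp only [Finset.sum_const, Finset.card_univ, Fintype.card_fin, smul_eq_mul, mul_one] at h2
  nlinarith

/-- The slack `(d - 1)² - e (δ - 1)² - (e - 1)(d - 1)` equals `e δ (e - 1)(δ - 1) ≥ 0`. -/
theorem genus_bound_arith {g G δ e N d : ℕ} (he : N + 1 = e) (hd : δ * e = d) (hδ : 0 < δ)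
    (hg : g ≤ (δ - 1) ^ 2) (hG : G + N ≤ (N + 1) * g + N * d) : G ≤ (d - 1) ^ 2 := by
  obtain ⟨δ, rfl⟩ : ∃ δ', δ = δ' + 1 := ⟨δ - 1, by omega⟩
  subst he hd
  rw [Nat.add_sub_cancel] at hg
  have h1 : (δ + 1) * (N + 1) - 1 = δ * N + δ + N := by
    rw [show (δ + 1) * (N + 1) = δ * N + δ + N + 1 by ring, Nat.add_sub_cancel]
  rw [h1]
  have h2 := Nat.mul_le_mul_left (N + 1) hg
  nlinarith [Nat.zero_le (δ * N), Nat.zero_le (δ * δ * N), Nat.zero_le (δ * N * N)]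

/-- A function field generated by functions that all have degree `d` has genus at most
`(d - 1) ^ 2`. -/
theorem finrank_logForms_le_sq {n : ℕ} {K : Type*} [Field K] [Algebra k K] (f : Fin (n + 1) → K)
    (hf : ∀ i, Transcendental k (f i)) (htop : adjoin k (Set.range f) = ⊤) {d : ℕ} (hd : 0 < d)
    (hfd : ∀ i, Module.finrank k⟮f i⟯ K = d) : Module.Finite k (logForms k (f 0) ∅) ∧
      Module.finrank k (logForms k (f 0) ∅) ≤ (d - 1) ^ 2 := by
  induction n generalizing K d with
  | zero =>
    have h0 : logForms k (f 0) ∅ = ⊥ := by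
      -- Any singleton serves here; `⊤` is merely an available valuation ring.
      refine eq_bot_iff.2 ((logForms_mono (Set.empty_subset {⊤})).trans_eq
        (logForms_singleton_eq_bot (hf 0) ?_ ⊤))
      rwa [show Set.range f = {f 0} from Set.range_unique (ι := Fin 1)] at htop
    rw [h0]
    exact ⟨inferInstance, by simp⟩
  | succ n ih =>
    let L : IntermediateField k K := adjoin k (Set.range fun i : Fin (n + 1) => f i.castSucc)
    let f' : Fin (n + 1) → L := fun i => ⟨f i.castSucc, subset_adjoin _ _ ⟨i, rfl⟩⟩
    have hf' : ∀ i, Transcendental k (f' i) := fun i h => hf i.castSucc (h.algebraMap (A := K))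
    have htop' : adjoin k (Set.range f') = ⊤ := by
      apply IntermediateField.map_injective L.val
      rw [adjoin_map, ← Set.range_comp, ← AlgHom.fieldRange_eq_map, fieldRange_val]
      rfl
    have hfin : ∀ i, FiniteDimensional k⟮f i⟯ K := fun i =>
      Module.finite_of_finrank_pos ((hfd i).symm ▸ hd)
    have hrank : ∀ i, Module.finrank k⟮f' i⟯ K = d := by
      intro i
      have h1 : Module.finrank k⟮f' i⟯ K = Module.finrank (lift k⟮f' i⟯) K :=
        Algebra.finrank_eq_of_equiv_equiv (liftAlgEquiv k⟮f' i⟯).toRingEquiv (RingEquiv.refl K)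
          (by ext; rfl)
      rw [h1, lift_adjoin_simple, ← hfd i.castSucc]
    have hfinK : ∀ i, FiniteDimensional k⟮f' i⟯ K := fun i =>
      Module.finite_of_finrank_pos ((hrank i).symm ▸ hd)
    have hfinL : ∀ i, FiniteDimensional k⟮f' i⟯ L := fun i => FiniteDimensional.left _ L K
    have hfinLK : FiniteDimensional L K := FiniteDimensional.right k⟮f' 0⟯ L K
    have hmul : ∀ i, Module.finrank k⟮f' i⟯ L * Module.finrank L K = d := fun i => by
      rw [Module.finrank_mul_finrank, hrank]
    have he : 0 < Module.finrank L K := Module.finrank_pos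
    obtain ⟨N, hN⟩ : ∃ N, N + 1 = Module.finrank L K := ⟨Module.finrank L K - 1, by omega⟩
    have hδ : 0 < Module.finrank k⟮f' 0⟯ L := Module.finrank_pos
    -- All coordinates have the same degree `d / [K : L]` on `L`, so the induction hypothesis
    -- applies to the smaller field.
    obtain ⟨h1, h2⟩ := ih f' hf' htop' hδ fun i =>
      Nat.eq_of_mul_eq_mul_right he ((hmul i).trans (hmul 0).symm)
    have hy : L⟮f (Fin.last _)⟯ = ⊤ := by
      rw [← restrictScalars_eq_top_iff (K := k), eq_top_iff, ← htop, adjoin_le_iff]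
      rintro _ ⟨i, rfl⟩
      refine Fin.lastCases ?_ (fun j => ?_) i
      · exact mem_adjoin_simple_self L _
      · exact IntermediateField.algebraMap_mem L⟮f (Fin.last _)⟯ (f' j)
    have := hfin (Fin.last _)
    obtain ⟨h3, h4⟩ := finrank_logForms_le_of_adjoin_simple_eq_top (hf' 0) (hf (Fin.last _)) hy hN
    rw [hfd] at h4
    exact ⟨h3, genus_bound_arith hN (hmul 0) hδ h2 h4⟩

end

end CurvePlace

end

noncomputable section

namespace CurvePlace

open Polynomial IntermediateField

variable {k L : Type*} [Field k] [Field L] [Algebra k L]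

/-! ### Regular differential forms -/

section

variable {B : Type*} [CommRing B] [IsDedekindDomain B] [Algebra B L] [IsFractionRing B L]

theorem isDiscreteValuationRing_of_algebraMap_mem {V : ValuationSubring L}
    (hB : ∀ b : B, algebraMap B L b ∈ V) (hV : V ≠ ⊤) : IsDiscreteValuationRing V := by
  let _ : Algebra B V := ((algebraMap B L).codRestrict V.toSubring hB).toAlgebra
  have hBV : ∀ b, ((algebraMap B V b : V) : L) = algebraMap B L b := fun _ => rfl
  let P := center V hB
  have : IsLocalization.AtPrime V P :=
    { map_units := fun s => (V.valuation_eq_one_iff _).2 ((notMem_center hB).1 s.2)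
      surj := fun z => by
        obtain ⟨a, s, hs, has⟩ := exists_mul_eq_of_mem hB hV z.2
        exact ⟨(a, ⟨s, hs⟩), Subtype.ext has⟩
      exists_of_eq := fun {a b} hab => ⟨1, by
        rw [IsFractionRing.injective B L (congrArg Subtype.val hab)]⟩ }
  exact IsLocalization.AtPrime.isDiscreteValuationRing_of_dedekind_domain B (center_ne_bot hB hV) V

end

section

variable [CharZero k] {t : L} [FiniteDimensional k⟮t⟯ L] {V : ValuationSubring L}

theorem IsPlace.isDiscreteValuationRing (hV : IsPlace k V) (htV : t ∈ V) :
    IsDiscreteValuationRing V := by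
  have := isDedekindDomain_integralClosure k t
  exact isDiscreteValuationRing_of_algebraMap_mem
    (hV.algebraMap_integralClosure_mem (y := t) htV) hV.2

/-- A derivation has bounded poles on `V`, and the bound is attained. By the Leibniz rule it
suffices to look at `t` and at generators of the finite `k[t]`-module `B`; the quotient rule then
passes from `B` to its localization `V`. -/
theorem IsPlace.exists_derivation_bound (hV : IsPlace k V) (htV : t ∈ V) (δ : Derivation k L L) :
    ∃ b₀ ∈ V, ∀ b ∈ V, V.valuation (δ b) ≤ V.valuation (δ b₀) := by
  classical
  have := isDedekindDomain_integralClosure k t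
  let A := Algebra.adjoin k {t}
  let B := integralClosure A L
  have hB : ∀ b : B, algebraMap B L b ∈ V := hV.algebraMap_integralClosure_mem htV
  obtain ⟨S, hS⟩ := (finite_integralClosure k t).fg_top
  obtain ⟨b₀, hb₀, hmax⟩ := (insert t (S.image (algebraMap B L))).exists_max_image
    (fun b => V.valuation (δ b)) (Finset.insert_nonempty _ _)
  have hmul : ∀ u v : L, u ∈ V → v ∈ V → V.valuation (δ u) ≤ V.valuation (δ b₀) →
      V.valuation (δ v) ≤ V.valuation (δ b₀) → V.valuation (δ (u * v)) ≤ V.valuation (δ b₀) := by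
    intro u v hu hv hδu hδv
    rw [δ.leibniz, smul_eq_mul, smul_eq_mul]
    refine (V.valuation.map_add _ _).trans (max_le ?_ ?_) <;> rw [map_mul]
    · exact mul_le_of_le_one_of_le ((V.valuation_le_one_iff _).2 hu) hδv
    · exact mul_le_of_le_one_of_le ((V.valuation_le_one_iff _).2 hv) hδu
  have hA : ∀ a : A, V.valuation (δ a) ≤ V.valuation (δ b₀) := by
    rintro ⟨a, ha⟩
    obtain ⟨p, rfl⟩ := Algebra.adjoin_mem_exists_aeval k t ha
    change V.valuation (δ (aeval t p)) ≤ _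
    rw [Derivation.map_aeval, smul_eq_mul, map_mul]
    refine mul_le_of_le_one_of_le ((V.valuation_le_one_iff _).2 ?_)
      (hmax t (Finset.mem_insert_self _ _))
    exact hB (algebraMap A B ⟨_, aeval_mem_adjoin_singleton k t⟩)
  have hBb : ∀ b : B, V.valuation (δ (algebraMap B L b)) ≤ V.valuation (δ b₀) := by
    intro b
    have hb : b ∈ Submodule.span A (S : Set B) := hS ▸ Submodule.mem_top
    induction hb using Submodule.span_induction with
    | mem s hs => exact hmax _ (Finset.mem_insert_of_mem (Finset.mem_image_of_mem _ hs))
    | zero => simp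
    | add u v _ _ hu hv =>
      rw [map_add, map_add]
      exact (V.valuation.map_add _ _).trans (max_le hu hv)
    | smul a u _ hu =>
      rw [Algebra.smul_def, map_mul]
      exact hmul _ _ (hB _) (hB _) (hA a) hu
  refine ⟨b₀, ?_, fun b hb => ?_⟩
  · rcases Finset.mem_insert.1 hb₀ with rfl | h
    · exact htV
    · obtain ⟨s, -, rfl⟩ := Finset.mem_image.1 h
      exact hB s
  · obtain ⟨a, s, hs, has⟩ := exists_mul_eq_of_mem hB hV.2 hb
    have h1 := congrArg δ has
    rw [δ.leibniz, smul_eq_mul, smul_eq_mul] at h1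
    have h2 : algebraMap B L s * δ b = δ (algebraMap B L a) - b * δ (algebraMap B L s) := by
      rw [← h1]; ring
    have h3 := congrArg V.valuation h2
    rw [map_mul, (notMem_center hB).1 hs, one_mul] at h3
    rw [h3]
    refine (V.valuation.map_sub _ _).trans (max_le (hBb a) ?_)
    rw [map_mul]
    exact mul_le_of_le_one_of_le ((V.valuation_le_one_iff _).2 hb) (hBb s)

/-- If `t` vanishes at `V`, the differential `dt / t` has exactly a simple pole at `V`. -/
theorem IsPlace.valuation_mul_derivation_lt [IsAlgClosed k] (hV : IsPlace k V)
    (ht : V.valuation t < 1) (δ : Derivation k L L) (hδ : δ t ≠ 0) {b : L} (hb : b ∈ V) :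
    V.valuation (t * δ b) < V.valuation (δ t) := by
  have htr : Algebra.trdeg k L ≤ 1 := trdeg_le_one_of_isAlgebraic (x := t)
  have htV : t ∈ V := (V.valuation_le_one_iff _).1 ht.le
  have ht0 : t ≠ 0 := by rintro rfl; simp at hδ
  obtain ⟨b₀, hb₀, hmax⟩ := hV.exists_derivation_bound htV δ
  have := hV.isDiscreteValuationRing htV
  obtain ⟨ϖ, hϖ⟩ := IsDiscreteValuationRing.exists_irreducible V
  obtain ⟨e, u, htu⟩ := IsDiscreteValuationRing.eq_unit_mul_pow_irreducible
    (x := (⟨t, htV⟩ : V)) (fun h => ht0 (congrArg Subtype.val h)) hϖ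
  have htu' : t = (u : V) * (ϖ : L) ^ e := congrArg Subtype.val htu
  have hu : V.valuation ((u : V) : L) = 1 := V.valuation_unit u
  have hϖ1 : V.valuation (ϖ : L) < 1 := by
    rw [← V.valuation_lt_one_iff]
    exact (IsLocalRing.mem_maximalIdeal _).2 hϖ.not_isUnit
  have hϖ0 : (ϖ : L) ≠ 0 := fun h => hϖ.ne_zero (Subtype.ext h)
  have hpos : 0 < V.valuation (δ b₀) := by
    refine lt_of_lt_of_le ?_ (hmax t htV)
    simpa [zero_lt_iff] using hδ
  -- From `b₀ - c = ϖ w` one gets `δ b₀ = ϖ δ w + w δ ϖ`, whose first term is strictly below the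
  -- maximum.
  have hϖmax : V.valuation (δ ϖ) = V.valuation (δ b₀) := by
    refine le_antisymm (hmax _ ϖ.2) ?_
    obtain ⟨c, hc⟩ := hV.exists_residue htr ((V.valuation_le_one_iff _).2 hb₀)
    have hmem : (⟨b₀ - algebraMap k L c, (V.valuation_le_one_iff _).1 hc.le⟩ : V) ∈
        IsLocalRing.maximalIdeal V := (V.valuation_lt_one_iff _).2 hc
    rw [hϖ.maximalIdeal_eq, Ideal.mem_span_singleton] at hmem
    obtain ⟨w, hw⟩ := hmem
    have hw' : b₀ - algebraMap k L c = ϖ * w := congrArg Subtype.val hw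
    have h1 := congrArg δ hw'
    rw [map_sub, δ.map_algebraMap, sub_zero, δ.leibniz, smul_eq_mul, smul_eq_mul] at h1
    by_contra! hlt
    have h2 : V.valuation (δ b₀) < V.valuation (δ b₀) := by
      conv_lhs => rw [h1]
      refine (V.valuation.map_add _ _).trans_lt (max_lt ?_ ?_) <;> rw [map_mul]
      · exact (mul_le_mul_right (hmax _ w.2) _).trans_lt (mul_lt_of_lt_one_left hpos hϖ1)
      · exact (mul_le_of_le_one_left zero_le (V.valuation_le_one w)).trans_lt hlt
    exact h2.false
  have he : e ≠ 0 := by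
    rintro rfl
    rw [htu', pow_zero, mul_one, hu] at ht
    exact ht.false
  obtain ⟨e, rfl⟩ := Nat.exists_eq_succ_of_ne_zero he
  -- With `t = u ϖ ^ (e + 1)`, the term `(e + 1) u ϖ ^ e δ ϖ` dominates, as `e + 1` is invertible in
  -- characteristic zero.
  have hδt : V.valuation (δ t) = V.valuation (ϖ : L) ^ e * V.valuation (δ b₀) := by
    have hδϖ0 : δ ϖ ≠ 0 := by
      intro h
      rw [h, map_zero] at hϖmax
      exact hpos.ne hϖmax
    have h1 : δ t = (ϖ : L) ^ e * (((e + 1 : ℕ) : L) * (u : V) * δ ϖ + ϖ * δ ((u : V) : L)) := by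
      rw [htu', δ.leibniz, δ.leibniz_pow, smul_eq_mul, smul_eq_mul, nsmul_eq_mul, smul_eq_mul]
      simp only [Nat.succ_eq_add_one, Nat.add_sub_cancel, pow_succ]
      ring
    have h2 : V.valuation (((e + 1 : ℕ) : L) * (u : V) * δ ϖ) = V.valuation (δ b₀) := by
      have : ((e + 1 : ℕ) : L) = algebraMap k L ((e + 1 : ℕ) : k) := by simp
      rw [map_mul, map_mul, hu, mul_one, this, hV.valuation_algebraMap
        (Nat.cast_ne_zero.2 (Nat.succ_ne_zero e)), one_mul, hϖmax]
    have h3 : V.valuation (ϖ * δ ((u : V) : L)) < V.valuation (δ b₀) := by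
      rw [map_mul]
      exact (mul_le_mul_right (hmax _ (u : V).2) _).trans_lt (mul_lt_of_lt_one_left hpos hϖ1)
    rw [h1, map_mul, map_pow, Valuation.map_add_eq_of_lt_left _ (h2.symm ▸ h3), h2]
  have hvt : V.valuation t = V.valuation (ϖ : L) ^ e * V.valuation (ϖ : L) := by
    rw [htu', map_mul, hu, one_mul, map_pow, pow_succ]
  have hϖe : 0 < V.valuation (ϖ : L) ^ e := by simp [zero_lt_iff, hϖ0]
  rw [hδt, map_mul, hvt, mul_assoc]
  refine mul_lt_mul_of_pos_left ?_ hϖe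
  exact (mul_le_mul_right (hmax b hb) _).trans_lt (mul_lt_of_lt_one_left hpos hϖ1)

end

theorem finiteDimensional_adjoin_simple_of_mem {x y : L} [hx : FiniteDimensional k⟮x⟯ L]
    (hxy : x ∈ k⟮y⟯) (hyx : y ∈ k⟮x⟯) : FiniteDimensional k⟮y⟯ L := by
  have h : k⟮x⟯ = k⟮y⟯ :=
    le_antisymm (adjoin_simple_le_iff.2 hxy) (adjoin_simple_le_iff.2 hyx)
  rwa [← h]

/-- Apply the previous estimate to `t = x - a`, where `δ t = 1`, or at a pole of `x` to `t = x⁻¹`,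
where `δ t = -t²`. -/
theorem IsPlace.valuation_derivation_mul_lt_one [CharZero k] [IsAlgClosed k] {x : L}
    [FiniteDimensional k⟮x⟯ L] {V : ValuationSubring L} (hV : IsPlace k V) (δ : Derivation k L L)
    (hδ : δ x = 1) {τ : L} (hτ : IsLogParam k x V τ) {b : L} (hb : b ∈ V) :
    V.valuation (δ b * τ) < 1 := by
  rcases hτ with ⟨a, rfl, ha⟩ | ⟨rfl, h1⟩
  · have hδ' : δ (x - algebraMap k L a) = 1 := by rw [map_sub, hδ, δ.map_algebraMap, sub_zero]
    have : FiniteDimensional k⟮x - algebraMap k L a⟯ L := by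
      refine finiteDimensional_adjoin_simple_of_mem (x := x) ?_
        (sub_mem (mem_adjoin_simple_self k x) (IntermediateField.algebraMap_mem _ a))
      simpa using add_mem (mem_adjoin_simple_self k (x - algebraMap k L a)) (IntermediateField.algebraMap_mem _ a)
    have h := hV.valuation_mul_derivation_lt ha δ (hδ' ▸ one_ne_zero) hb
    rwa [hδ', map_one, mul_comm] at h
  · have hx0 : τ ≠ 0 := by rintro rfl; simp at h1
    have : FiniteDimensional k⟮τ⁻¹⟯ L := by
      refine finiteDimensional_adjoin_simple_of_mem (x := τ) ?_
        (inv_mem (mem_adjoin_simple_self k τ))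
      simpa using inv_mem (mem_adjoin_simple_self k τ⁻¹)
    have hlt : V.valuation τ⁻¹ < 1 := by
      rw [map_inv₀]
      exact (inv_lt_one₀ (by simp [zero_lt_iff, hx0])).2 h1
    have hδ' : δ τ⁻¹ = -(τ⁻¹ * τ⁻¹) := by
      rw [Derivation.leibniz_inv, hδ, smul_eq_mul, mul_one, pow_two]
    have h := hV.valuation_mul_derivation_lt hlt δ (by rw [hδ']; simpa using hx0) hb
    rw [hδ', Valuation.map_neg, map_mul, map_mul] at h
    have h2 := lt_of_mul_lt_mul_left h zero_le
    rw [map_inv₀] at h2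
    rw [map_mul]
    have hpos : 0 < V.valuation τ := by simp [zero_lt_iff, hx0]
    calc V.valuation (δ b) * V.valuation τ < (V.valuation τ)⁻¹ * V.valuation τ :=
          mul_lt_mul_of_pos_right h2 hpos
      _ = 1 := inv_mul_cancel₀ hpos.ne'

/-! ### Comparison with Kähler differentials -/

/-- The maps `k[X] → k(x) → L` are formally étale (a localization, then a separable extension), so
`Ω[L⁄k]` is free on `dx`. -/
theorem exists_linearMap_kaehlerDifferential [CharZero k] {x : L} (hx : Transcendental k x)
    [FiniteDimensional k⟮x⟯ L] :
    ∃ φ : Ω[L⁄k] →ₗ[L] L, Function.Injective φ ∧ φ (KaehlerDifferential.D k L x) = 1 := by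
  let _ : Algebra k[X] k⟮x⟯ := (aeval (AdjoinSimple.gen k x)).toAlgebra
  let _ : Algebra k[X] L := (aeval x).toAlgebra
  have hmap : ∀ p : k[X], algebraMap k[X] L p = aeval x p := fun _ => rfl
  have : IsScalarTower k k[X] k⟮x⟯ := .of_algebraMap_eq' (aeval _).comp_algebraMap.symm
  have : IsScalarTower k k[X] L := .of_algebraMap_eq' (aeval _).comp_algebraMap.symm
  have : IsScalarTower k[X] k⟮x⟯ L := .of_algebraMap_eq fun p => by
    change aeval x p = algebraMap k⟮x⟯ L (aeval (AdjoinSimple.gen k x) p)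
    rw [← aeval_algebraMap_apply, AdjoinSimple.algebraMap_gen]
  have hinj : Function.Injective (algebraMap k[X] k⟮x⟯) := by
    refine Function.Injective.of_comp (f := algebraMap k⟮x⟯ L) ?_
    rw [← RingHom.coe_comp, ← IsScalarTower.algebraMap_eq]
    exact transcendental_iff_injective.1 hx
  have : FaithfulSMul k[X] k⟮x⟯ := (faithfulSMul_iff_algebraMap_injective _ _).2 hinj
  have : IsFractionRing k[X] k⟮x⟯ := by
    refine IsFractionRing.of_field _ _ fun z => ?_
    obtain ⟨r, s, hrs⟩ := mem_adjoin_simple_iff k z.1 |>.1 z.2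
    refine ⟨r, s, (algebraMap k⟮x⟯ L).injective ?_⟩
    rw [map_div₀, ← IsScalarTower.algebraMap_apply, ← IsScalarTower.algebraMap_apply]
    exact hrs
  have : Algebra.FormallyEtale k[X] k⟮x⟯ :=
    Algebra.FormallyEtale.of_isLocalization (nonZeroDivisors k[X])
  have : Algebra.FormallyEtale k⟮x⟯ L := Algebra.FormallyEtale.of_isSeparable _ _
  have : Algebra.FormallyEtale k[X] L := Algebra.FormallyEtale.comp k[X] k⟮x⟯ L
  let e : Ω[L⁄k] ≃ₗ[L] L :=
    (KaehlerDifferential.tensorKaehlerEquivOfFormallyEtale k k[X] L).symm ≪≫ₗ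
      (KaehlerDifferential.polynomialEquiv k).baseChange k[X] L _ _ ≪≫ₗ
      TensorProduct.AlgebraTensorModule.rid k[X] L L
  refine ⟨e, e.injective, ?_⟩
  have hX : x = algebraMap k[X] L X := by rw [hmap, aeval_X]
  change e (KaehlerDifferential.D k L x) = 1
  conv_lhs => rw [hX]
  simp [e, KaehlerDifferential.tensorKaehlerEquivOfFormallyEtale_symm_D_algebraMap]

/-- The differential forms which are regular at the place `V`. -/
def regularAt (k : Type*) {L : Type*} [Field k] [Field L] [Algebra k L] (V : ValuationSubring L) :
    Submodule k (Ω[L⁄k]) :=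
  Submodule.span k {ω | ∃ a ∈ V, ∃ b ∈ V, ω = a • KaehlerDifferential.D k L b}

/-- The map is `h dx ↦ h`; it bounds the dimension of a space of regular differentials by that of
`logForms k x ∅`. -/
theorem exists_linearMap_regularAt [CharZero k] [IsAlgClosed k] {x : L} (hx : Transcendental k x)
    [FiniteDimensional k⟮x⟯ L] (W : Submodule k (Ω[L⁄k]))
    (hW : ∀ V : ValuationSubring L, IsPlace k V → W ≤ regularAt k V) :
    ∃ φ : W →ₗ[k] logForms k x ∅, Function.Injective φ := by
  obtain ⟨φ, hφ, hφx⟩ := exists_linearMap_kaehlerDifferential hx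
  let δ : Derivation k L L := φ.compDer (KaehlerDifferential.D k L)
  have hδ : δ x = 1 := hφx
  refine ⟨((φ.restrictScalars k).domRestrict W).codRestrict _ fun ω => ?_,
    fun a b hab => Subtype.ext (hφ (congrArg Subtype.val hab))⟩
  rw [mem_logForms_empty]
  intro V hV τ hτ
  obtain ⟨ω, hω⟩ := ω
  have hω' := hW V hV hω
  change V.valuation (φ ω * τ) < 1
  clear hω
  induction hω' using Submodule.span_induction with
  | mem ω h =>
    obtain ⟨a, ha, b, hb, rfl⟩ := h
    rw [map_smul, smul_eq_mul, mul_assoc, map_mul]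
    have h := hV.valuation_derivation_mul_lt_one δ hδ hτ hb
    exact mul_lt_one_of_nonneg_of_lt_one_right ((V.valuation_le_one_iff _).2 ha) zero_le h
  | zero => simp
  | add u v _ _ hu hv =>
    rw [map_add, add_mul]
    exact V.valuation.map_add_lt hu hv
  | smul c u _ hu =>
    rw [LinearMap.map_smul_of_tower, Algebra.smul_def, mul_assoc, map_mul]
    refine mul_lt_one_of_nonneg_of_lt_one_right ((V.valuation_le_one_iff _).2 (hV.1 c)) zero_le hu

theorem subsingleton_kaehlerDifferential (h : ∀ a : L, a ∈ Set.range (algebraMap k L)) :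
    Subsingleton (Ω[L⁄k]) := by
  have := KaehlerDifferential.subsingleton_of_surjective k L h
  infer_instance

end CurvePlace

end

noncomputable section

namespace CurvePlace

open Polynomial IntermediateField

/-! ### Field-valued points of schemes -/

section

open Scheme IsLocalRing

universe u

/-- The two stalks sit at points that are not syntactically equal; the classification
`SpecToEquivOfLocalRing` of points by pairs avoids transporting between them. -/
theorem range_stalkClosedPointTo_specMap_comp {R S : CommRingCat.{u}} [IsLocalRing R]
    [IsLocalRing S] (φ : R ⟶ S) [IsLocalHom φ.hom] {X : Scheme.{u}} (g : Spec R ⟶ X) :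
    Set.range (stalkClosedPointTo (Spec.map φ ≫ g)).hom =
      φ.hom '' Set.range (stalkClosedPointTo g).hom := by
  have : IsLocalHom (stalkClosedPointTo g ≫ φ).hom := by
    rw [CommRingCat.hom_comp]; exact RingHom.isLocalHom_comp _ _
  let a : Σ x, { f : X.presheaf.stalk x ⟶ S // IsLocalHom f.hom } :=
    ⟨g (closedPoint R), stalkClosedPointTo g ≫ φ, this⟩
  have h : (SpecToEquivOfLocalRing X S).symm a = Spec.map φ ≫ g := by
    change Spec.map (stalkClosedPointTo g ≫ φ) ≫ X.fromSpecStalk _ = _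
    rw [Spec.map_comp, Category.assoc, Spec_stalkClosedPointTo_fromSpecStalk]
  have h2 : SpecToEquivOfLocalRing X S (Spec.map φ ≫ g) = a := by
    rw [← h, Equiv.apply_symm_apply]
  have h3 := congrArg (fun s : Σ x, { f : X.presheaf.stalk x ⟶ S // IsLocalHom f.hom } =>
    Set.range s.2.1.hom) h2
  refine h3.trans ?_
  change Set.range (stalkClosedPointTo g ≫ φ).hom = _
  rw [CommRingCat.hom_comp, RingHom.coe_comp, Set.range_comp]

theorem surjective_stalkClosedPointTo_fromSpecStalk (X : Scheme.{u}) (x : X) :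
    Function.Surjective (stalkClosedPointTo (X.fromSpecStalk x)).hom := by
  rw [stalkClosedPointTo_fromSpecStalk]
  exact (ConcreteCategory.bijective_of_isIso (X.presheaf.stalkCongr _).hom).2

variable {F : Type u} [Field F]

theorem range_stalkClosedPointTo_comp_subset {X Y : Scheme.{u}} (g : Spec (.of F) ⟶ X) (h : X ⟶ Y) :
    Set.range (stalkClosedPointTo (g ≫ h)).hom ⊆ Set.range (stalkClosedPointTo g).hom := by
  rintro _ ⟨a, rfl⟩
  rw [stalkClosedPointTo_comp]
  exact ⟨_, rfl⟩

/-- The subfield of `F` which is the image of the residue field at an `F`-valued point. -/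
def residueSubfield {X : Scheme.{u}} (g : Spec (.of F) ⟶ X) : Subfield F where
  __ := (stalkClosedPointTo g).hom.range
  inv_mem' := by
    rintro _ ⟨a, rfl⟩
    by_cases h : (stalkClosedPointTo g).hom a = 0
    · rw [h, inv_zero]
      exact zero_mem (stalkClosedPointTo g).hom.range
    · have hu : IsUnit a := isUnit_of_map_unit (stalkClosedPointTo g).hom a (IsUnit.mk0 _ h)
      obtain ⟨b, hb⟩ := hu.exists_right_inv
      refine ⟨b, eq_inv_of_mul_eq_one_right ?_⟩
      rw [← map_mul, hb, map_one]

theorem residueSubfield_comp_le {X Y : Scheme.{u}} (g : Spec (.of F) ⟶ X) (h : X ⟶ Y) :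
    residueSubfield (g ≫ h) ≤ residueSubfield g := range_stalkClosedPointTo_comp_subset g h

theorem residueSubfield_comp_of_surjective {X Y : Scheme.{u}} (g : Spec (.of F) ⟶ X) (h : X ⟶ Y)
    (hh : Function.Surjective (h.stalkMap (g (closedPoint F))).hom) :
    residueSubfield (g ≫ h) = residueSubfield g := by
  refine le_antisymm (residueSubfield_comp_le g h) ?_
  rintro _ ⟨a, rfl⟩
  obtain ⟨b, rfl⟩ := hh a
  refine ⟨b, ?_⟩
  rw [stalkClosedPointTo_comp]
  rfl

theorem injective_stalkClosedPointTo_comp {X Y : Scheme.{u}} (g : Spec (.of F) ⟶ X) (h : X ⟶ Y)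
    (hg : Function.Injective (stalkClosedPointTo g).hom)
    (hh : Function.Injective (h.stalkMap (g (closedPoint F))).hom) :
    Function.Injective (stalkClosedPointTo (g ≫ h)).hom := by
  rw [stalkClosedPointTo_comp]
  exact hg.comp hh

/-- A point factors through the spectrum of a subfield if and only if this subfield contains the
residue field. -/
theorem residueSubfield_le_iff {X : Scheme.{u}} (g : Spec (.of F) ⟶ X) (M : Subfield F) :
    residueSubfield g ≤ M ↔
      ∃ g' : Spec (.of M) ⟶ X, Spec.map (CommRingCat.ofHom M.subtype) ≫ g' = g := by
  constructor
  · intro h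
    refine ⟨Spec.map (CommRingCat.ofHom ((stalkClosedPointTo g).hom.codRestrict M
      fun a => h ⟨a, rfl⟩)) ≫ X.fromSpecStalk _, ?_⟩
    rw [← Category.assoc, ← Spec.map_comp]
    exact Spec_stalkClosedPointTo_fromSpecStalk g
  · rintro ⟨g', rfl⟩
    intro z hz
    have hz' : z ∈ Set.range (stalkClosedPointTo
        (Spec.map (CommRingCat.ofHom M.subtype) ≫ g')).hom := hz
    have : IsLocalHom (CommRingCat.ofHom M.subtype).hom :=
      inferInstanceAs (IsLocalHom M.subtype)
    rw [range_stalkClosedPointTo_specMap_comp] at hz'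
    obtain ⟨w, -, rfl⟩ := hz'
    exact w.2

theorem stalkClosedPointTo_specMap_toStalk {A : CommRingCat.{u}} (ψ : A ⟶ .of F) (a : A) :
    (stalkClosedPointTo (Spec.map ψ)).hom ((StructureSheaf.toStalk A _).hom a) = ψ.hom a := by
  have h := germ_stalkClosedPointTo_Spec ψ
  have h2 := congrArg (fun f => f.hom ((ΓSpecIso A).inv a)) h
  refine Eq.trans ?_ (h2.trans ?_)
  · rfl
  · simp

theorem apply_mem_residueSubfield_specMap {A : CommRingCat.{u}} (ψ : A ⟶ .of F) (a : A) :
    ψ.hom a ∈ residueSubfield (Spec.map ψ) :=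
  ⟨_, stalkClosedPointTo_specMap_toStalk ψ a⟩

theorem residueSubfield_specMap_le {A : CommRingCat.{u}} (ψ : A ⟶ .of F) {M : Subfield F}
    (h : ∀ a, ψ.hom a ∈ M) : residueSubfield (Spec.map ψ) ≤ M := by
  rw [residueSubfield_le_iff]
  refine ⟨Spec.map (CommRingCat.ofHom (ψ.hom.codRestrict M h)), ?_⟩
  rw [← Spec.map_comp]
  rfl

theorem injective_stalkClosedPointTo_specMap {A : CommRingCat.{u}} (ψ : A ⟶ .of F)
    (h : Function.Injective ψ.hom) : Function.Injective (stalkClosedPointTo (Spec.map ψ)).hom := by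
  rw [injective_iff_map_eq_zero]
  intro z hz
  let p : PrimeSpectrum A := (Spec.map ψ) (closedPoint F)
  obtain ⟨⟨a, s⟩, has⟩ := IsLocalization.surj (M := p.asIdeal.primeCompl)
    (S := (Spec.structureSheaf A).presheaf.stalk p) z
  let j : A →+* (Spec A).presheaf.stalk (Spec.map ψ (closedPoint F)) :=
    (StructureSheaf.toStalk A p).hom
  have hj : ∀ a, (stalkClosedPointTo (Spec.map ψ)).hom (j a) = ψ.hom a :=
    stalkClosedPointTo_specMap_toStalk ψ
  have h1 : z * j s = j a := has
  have h2 := congrArg (stalkClosedPointTo (Spec.map ψ)).hom h1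
  rw [map_mul, hz, zero_mul, hj] at h2
  have ha : a = 0 := h (by rw [← h2, map_zero])
  have hs : IsUnit (j s) :=
    IsLocalization.map_units (M := p.asIdeal.primeCompl)
      ((Spec.structureSheaf A).presheaf.stalk p) s
  rw [ha, map_zero] at h1
  exact (hs.mul_left_eq_zero).1 h1

end

end CurvePlace

end

noncomputable section

namespace CurvePlace

open Polynomial IntermediateField

/-! ### Field-valued points of the projective line -/

section

open CurveGenus Scheme IsLocalRing HomogeneousLocalization

theorem X_mem_P1Grading (i : Fin 2) : (MvPolynomial.X i : MvPolynomial (Fin 2) ℂ) ∈ P1Grading 1 :=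
  MvPolynomial.isHomogeneous_X _ _

/-- The coordinate `xᵢ / xⱼ` on the standard open subset `xⱼ ≠ 0` of the projective line. -/
abbrev awayCoord (i j : Fin 2) : Away P1Grading (MvPolynomial.X j : MvPolynomial (Fin 2) ℂ) :=
  Away.isLocalizationElem (X_mem_P1Grading j) (X_mem_P1Grading i)

/-- The constants on the standard open subset `xⱼ ≠ 0` of the projective line. -/
abbrev awayConst (j : Fin 2) : ℂ →+* Away P1Grading (MvPolynomial.X j : MvPolynomial (Fin 2) ℂ) :=
  (fromZeroRingHom P1Grading _).comp (algebraMap ℂ (P1Grading 0))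

theorem adjoin_range_pair_eq_top {i j : Fin 2} (hij : i ≠ j) :
    Algebra.adjoin (P1Grading 0)
      (Set.range ![(MvPolynomial.X j : MvPolynomial (Fin 2) ℂ), MvPolynomial.X i]) = ⊤ := by
  rw [eq_top_iff]
  rintro p -
  induction p using MvPolynomial.induction_on with
  | C a => exact Subalgebra.algebraMap_mem _ (algebraMap ℂ (P1Grading 0) a)
  | add p q hp hq => exact add_mem hp hq
  | mul_X p l hp =>
    refine mul_mem hp (Algebra.subset_adjoin ?_)
    by_cases h : l = j
    · exact ⟨0, by rw [h]; rfl⟩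
    · exact ⟨1, by rw [show l = i by omega]; rfl⟩

theorem exists_eval₂_awayCoord {i j : Fin 2} (hij : i ≠ j)
    (a : Away P1Grading (MvPolynomial.X j : MvPolynomial (Fin 2) ℂ)) :
    ∃ P : ℂ[X], eval₂ (awayConst j) (awayCoord i j) P = a := by
  have h := Away.span_mk_prod_pow_eq_top (X_mem_P1Grading j) _ (adjoin_range_pair_eq_top hij)
    (fun _ => 1) (fun l => by fin_cases l <;> exact X_mem_P1Grading _)
  have ha := h.ge (Submodule.mem_top (x := a))
  induction ha using Submodule.span_induction with
  | mem a ha =>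
    obtain ⟨m, e, he, rfl⟩ := ha
    -- Here `e 1` is the exponent of `xᵢ`, and the powers of `xⱼ` cancel since `e 0 + e 1 = m`.
    refine ⟨X ^ e 1, ?_⟩
    rw [eval₂_X_pow]
    apply val_injective
    have hm : e 0 + e 1 = m := by simpa using he
    subst hm
    rw [val_pow, Away.val_mk, Away.val_mk, Localization.mk_pow, Localization.mk_eq_mk_iff,
      Localization.r_iff_exists]
    refine ⟨1, ?_⟩
    simp [Fin.prod_univ_two]
    ring
  | zero => exact ⟨0, eval₂_zero _ _⟩
  | add u v _ _ hu hv =>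
    obtain ⟨P, rfl⟩ := hu
    obtain ⟨Q, rfl⟩ := hv
    exact ⟨P + Q, eval₂_add _ _⟩
  | smul c u _ hu =>
    obtain ⟨P, rfl⟩ := hu
    obtain ⟨c, rfl⟩ := algebraMap_grading_zero_bijective.2 c
    refine ⟨C c * P, ?_⟩
    rw [eval₂_mul, eval₂_C, Algebra.smul_def]
    rfl

theorem exists_mem_basicOpen_X (p : Proj P1Grading) :
    ∃ j : Fin 2, p ∈ Proj.basicOpen P1Grading (MvPolynomial.X j) := by
  have h := Proj.iSup_basicOpen_eq_top' P1Grading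
    ![(MvPolynomial.X 0 : MvPolynomial (Fin 2) ℂ), MvPolynomial.X 1]
    (fun l => ⟨1, by fin_cases l <;> exact X_mem_P1Grading _⟩)
    (adjoin_range_pair_eq_top (by decide))
  have hp : p ∈ (⊤ : (Proj P1Grading).Opens) := trivial
  rw [← h, TopologicalSpace.Opens.mem_iSup] at hp
  obtain ⟨l, hl⟩ := hp
  exact ⟨l, by fin_cases l <;> exact hl⟩

/-- The standard chart `xⱼ ≠ 0` of the projective line. -/
abbrev P1Chart (j : Fin 2) :
    Spec (.of (Away P1Grading (MvPolynomial.X j : MvPolynomial (Fin 2) ℂ))) ⟶ Proj P1Grading :=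
  Proj.awayι P1Grading (MvPolynomial.X j) (X_mem_P1Grading j) one_pos

variable {F : Type} [Field F]

/-- Injectivity of `ψ` places the point at the zero ideal of the chart, which specializes to every
other point there. -/
theorem range_P1Chart_subset_closure {g : Spec (.of F) ⟶ P1.left} {j : Fin 2}
    {ψ : Away P1Grading (MvPolynomial.X j : MvPolynomial (Fin 2) ℂ) →+* F}
    (hg : g = Spec.map (CommRingCat.ofHom ψ) ≫ P1Chart j)
    (hψ : Function.Injective ψ) : Set.range (P1Chart j) ⊆ closure {g (closedPoint F)} := by
  rintro _ ⟨z, rfl⟩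
  have hz : z ∈ closure {Spec.map (CommRingCat.ofHom ψ) (closedPoint F)} := by
    rw [← specializes_iff_mem_closure]
    refine (PrimeSpectrum.le_iff_specializes (Spec.map (CommRingCat.ofHom ψ) (closedPoint F)) z).1 ?_
    intro a ha
    have h0 : ψ a ∈ (closedPoint F).asIdeal := ha
    have h1 : ψ a = 0 := by
      change ψ a ∈ maximalIdeal F at h0
      rwa [maximalIdeal_eq_bot, Ideal.mem_bot] at h0
    rw [(injective_iff_map_eq_zero ψ).1 hψ a h1]
    exact zero_mem _
  have h := image_closure_subset_closure_image (P1Chart j).continuous ⟨z, hz, rfl⟩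
  rw [Set.image_singleton] at h
  rw [hg]
  exact h

theorem mem_basicOpen_of_factor {g : Spec (.of F) ⟶ P1.left} {i j : Fin 2}
    {ψ : Away P1Grading (MvPolynomial.X j : MvPolynomial (Fin 2) ℂ) →+* F}
    (hg : g = Spec.map (CommRingCat.ofHom ψ) ≫ P1Chart j) (h0 : ψ (awayCoord i j) ≠ 0) :
    g (closedPoint F) ∈ Proj.basicOpen P1Grading (MvPolynomial.X i) := by
  have h : Spec.map (CommRingCat.ofHom ψ) (closedPoint F) ∈
      P1Chart j ⁻¹ᵁ Proj.basicOpen P1Grading (MvPolynomial.X i) := by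
    rw [Proj.awayι_preimage_basicOpen P1Grading (X_mem_P1Grading j) one_pos (X_mem_P1Grading i)
      one_pos]
    change ψ (awayCoord i j) ∉ maximalIdeal F
    rwa [maximalIdeal_eq_bot, Ideal.mem_bot]
  rw [hg]
  exact h

variable [Algebra ℂ F]

theorem exists_factor_P1Chart (g : Spec (.of F) ⟶ P1.left)
    (hg : g ≫ P1.hom = Spec.map (CommRingCat.ofHom (algebraMap ℂ F))) {j : Fin 2}
    (hj : g (closedPoint F) ∈ Proj.basicOpen P1Grading (MvPolynomial.X j)) :
    ∃ ψ : Away P1Grading (MvPolynomial.X j : MvPolynomial (Fin 2) ℂ) →+* F,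
      g = Spec.map (CommRingCat.ofHom ψ) ≫ P1Chart j ∧
        ∀ c, ψ (awayConst j c) = algebraMap ℂ F c := by
  let g' : Spec (.of F) ⟶ Proj P1Grading := g
  have hr : Set.range g' ⊆ Set.range (P1Chart j) := by
    rintro _ ⟨z, rfl⟩
    have hz : z = closedPoint F := Subsingleton.elim (α := PrimeSpectrum F) _ _
    have := (Proj.opensRange_awayι P1Grading (MvPolynomial.X j) (X_mem_P1Grading j) one_pos).ge hj
    rw [hz]
    exact this
  obtain ⟨ψ, hψ⟩ := Spec.map_surjective (IsOpenImmersion.lift (P1Chart j) g' hr)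
  have hfac : g = Spec.map ψ ≫ P1Chart j := by
    rw [hψ]; exact (IsOpenImmersion.lift_fac (P1Chart j) g' hr).symm
  refine ⟨ψ.hom, hfac, fun c => ?_⟩
  have h2 : Spec.map ((CommRingCat.ofHom (awayConst j)) ≫ ψ) =
      Spec.map (CommRingCat.ofHom (algebraMap ℂ F)) := by
    rw [← hg, hfac, CommRingCat.ofHom_comp, Category.assoc, Spec.map_comp, Spec.map_comp,
      ← Proj.awayι_toSpecZero P1Grading (MvPolynomial.X j) (X_mem_P1Grading j) one_pos]
    simp only [Category.assoc]
    rfl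
  have h3 := Spec.map_injective h2
  exact congrArg (fun f : CommRingCat.of ℂ ⟶ CommRingCat.of F => f.hom c) h3

section

variable {g : Spec (.of F) ⟶ P1.left} {i j : Fin 2}
  {ψ : Away P1Grading (MvPolynomial.X j : MvPolynomial (Fin 2) ℂ) →+* F}

theorem apply_eval₂_awayCoord (hc : ∀ c, ψ (awayConst j c) = algebraMap ℂ F c) (P : ℂ[X]) :
    ψ (eval₂ (awayConst j) (awayCoord i j) P) = aeval (ψ (awayCoord i j)) P := by
  rw [hom_eval₂, aeval_def]
  congr 1
  exact RingHom.ext hc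

theorem residueSubfield_of_factor (hij : i ≠ j)
    (hg : g = Spec.map (CommRingCat.ofHom ψ) ≫ P1Chart j)
    (hc : ∀ c, ψ (awayConst j c) = algebraMap ℂ F c) :
    residueSubfield g = ℂ⟮ψ (awayCoord i j)⟯.toSubfield := by
  have h1 : residueSubfield g = residueSubfield (Spec.map (CommRingCat.ofHom ψ)) := by
    rw [hg]
    refine residueSubfield_comp_of_surjective _ _ ?_
    exact (ConcreteCategory.bijective_of_isIso ((P1Chart j).stalkMap _)).2
  have hmem : ∀ a, ψ a ∈ residueSubfield g := fun a => by
    rw [h1]; exact apply_mem_residueSubfield_specMap (CommRingCat.ofHom ψ) a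
  refine le_antisymm ?_ ?_
  · rw [h1]
    refine residueSubfield_specMap_le _ fun a => ?_
    obtain ⟨P, rfl⟩ := exists_eval₂_awayCoord hij a
    change ψ _ ∈ _
    rw [apply_eval₂_awayCoord hc]
    exact algebra_adjoin_le_adjoin ℂ _ (aeval_mem_adjoin_singleton ℂ _)
  · let E : IntermediateField ℂ F :=
      (residueSubfield g).toIntermediateField fun c => hc c ▸ hmem _
    have h2 : ℂ⟮ψ (awayCoord i j)⟯ ≤ E := adjoin_simple_le_iff.2 (hmem _)
    exact h2

theorem injective_of_factor (hij : i ≠ j) (hc : ∀ c, ψ (awayConst j c) = algebraMap ℂ F c)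
    (ht : Transcendental ℂ (ψ (awayCoord i j))) : Function.Injective ψ := by
  rw [injective_iff_map_eq_zero]
  intro a ha
  obtain ⟨P, rfl⟩ := exists_eval₂_awayCoord hij a
  rw [apply_eval₂_awayCoord hc] at ha
  rw [transcendental_iff.1 ht P ha, eval₂_zero]

end

/-- Every point of the projective line with values in a field `F` has a coordinate `f`, which
generates its residue field; if `f` is transcendental, the point is generic. -/
theorem exists_residueSubfield_eq_adjoin_simple (g : Spec (.of F) ⟶ P1.left)
    (hg : g ≫ P1.hom = Spec.map (CommRingCat.ofHom (algebraMap ℂ F))) :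
    ∃ f : F, residueSubfield g = ℂ⟮f⟯.toSubfield ∧ (Transcendental ℂ f →
      Function.Injective (stalkClosedPointTo g).hom ∧ closure {g (closedPoint F)} = Set.univ) := by
  obtain ⟨j, hj⟩ := exists_mem_basicOpen_X (g (closedPoint F))
  obtain ⟨i, hij⟩ := exists_ne j
  obtain ⟨ψ, hfac, hc⟩ := exists_factor_P1Chart g hg hj
  have hres := residueSubfield_of_factor hij hfac hc
  refine ⟨ψ (awayCoord i j), hres, fun ht => ⟨?_, Set.eq_univ_of_forall fun p => ?_⟩⟩
  · have h1 := injective_stalkClosedPointTo_specMap (CommRingCat.ofHom ψ)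
      (injective_of_factor hij hc ht)
    rw [hfac]
    exact injective_stalkClosedPointTo_comp _ _ h1
      (ConcreteCategory.bijective_of_isIso ((P1Chart j).stalkMap _)).1
  · obtain ⟨l, hl⟩ := exists_mem_basicOpen_X p
    replace hl := (Proj.opensRange_awayι P1Grading (MvPolynomial.X l)
      (X_mem_P1Grading l) one_pos).ge hl
    by_cases hlj : l = j
    · subst hlj
      exact range_P1Chart_subset_closure hfac (injective_of_factor hij hc ht) hl
    obtain rfl : l = i := by omega
    -- The point also lies in the other chart. Its coordinate there generates the same field, so it
    -- is again transcendental.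
    have h0 : ψ (awayCoord l j) ≠ 0 := fun h => ht (h ▸ isAlgebraic_zero)
    obtain ⟨ψ', hfac', hc'⟩ := exists_factor_P1Chart g hg (mem_basicOpen_of_factor hfac h0)
    have hres' := residueSubfield_of_factor (Ne.symm hlj) hfac' hc'
    have heq : ℂ⟮ψ (awayCoord l j)⟯ = ℂ⟮ψ' (awayCoord j l)⟯ :=
      toSubfield_injective (hres.symm.trans hres')
    have ht' : Transcendental ℂ (ψ' (awayCoord j l)) := by
      intro halg
      obtain ⟨c, hc⟩ := eq_algebraMap_of_isAlgebraic halg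
      refine ht ?_
      have hmem : ψ (awayCoord l j) ∈ ℂ⟮ψ' (awayCoord j l)⟯ := heq ▸ mem_adjoin_simple_self ℂ _
      have hle : ℂ⟮ψ' (awayCoord j l)⟯ ≤ ⊥ :=
        adjoin_simple_le_iff.2 (mem_bot.2 ⟨c, by rw [hc]⟩)
      obtain ⟨c', hc'⟩ := mem_bot.1 (hle hmem)
      rw [← hc']
      exact isAlgebraic_algebraMap c'
    exact range_P1Chart_subset_closure hfac' (injective_of_factor (Ne.symm hlj) hc' ht') hl

end

end CurvePlace

end

/-! ### Degrees of morphisms in terms of subfields generated by coordinates. -/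

noncomputable section

namespace CurvePlace

open IntermediateField

section

open CurveGenus Scheme IsLocalRing

variable {F : Type} [Field F]

/-- A nonzero element of the kernel would annihilate `F` and make its rank zero. Thus a nonzero
`degree` forces the local ring at the image of the generic point to embed. -/
theorem injective_of_finrank_ne_zero {O : Type} [CommRing O] (κ : O →+* F)
    (h : @Module.finrank O F _ _ κ.toAlgebra.toModule ≠ 0) : Function.Injective κ := by
  let _ := κ.toAlgebra
  have : Nontrivial O := κ.domain_nontrivial
  by_contra hinj
  rw [injective_iff_map_eq_zero] at hinj
  push Not at hinj
  obtain ⟨c, hc, hc0⟩ := hinj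
  refine h (Module.finrank_eq_zero_of_rank_eq_zero ?_)
  rw [rank_eq_zero_iff]
  intro z
  refine ⟨c, hc0, ?_⟩
  rw [Algebra.smul_def, RingHom.algebraMap_toAlgebra, hc, zero_mul]

theorem degree_eq_finrank_stalkClosedPointTo {C Y : Scheme.{0}} [IsIntegral C] (h : C ⟶ Y)
    [hdom : IsDominant h] (g : Spec (.of F) ⟶ C) (hg : g (closedPoint F) = genericPoint C)
    (hb : Function.Bijective (stalkClosedPointTo g).hom) :
    degree h = @Module.finrank _ F _ _ (stalkClosedPointTo (g ≫ h)).hom.toAlgebra.toModule := by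
  have key : ∀ (x : C) (_ : x = genericPoint C) (α : C.presheaf.stalk x ⟶ .of F)
      (_ : Function.Bijective α.hom), degree h =
        @Module.finrank (Y.presheaf.stalk (h x)) F _ _ (h.stalkMap x ≫ α).hom.toAlgebra.toModule := by
    rintro _ rfl α hα
    rw [degree, if_pos hdom]
    let _ : Algebra (Y.presheaf.stalk (h (genericPoint C))) C.functionField :=
      (h.stalkMap (genericPoint C)).hom.toAlgebra
    let _ : Algebra (Y.presheaf.stalk (h (genericPoint C))) F :=
      (h.stalkMap (genericPoint C) ≫ α).hom.toAlgebra
    exact Algebra.finrank_eq_of_equiv_equiv (RingEquiv.refl _) (RingEquiv.ofBijective α.hom hα)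
      (RingHom.ext fun _ => rfl)
  rw [key _ hg _ hb, stalkClosedPointTo_comp]
  rfl

variable [Algebra ℂ F]

/-- The coordinates of a point of `(ℙ¹)ⁿ` generate its residue field. -/
theorem adjoin_range_eq_top_of_residueSubfield {n : ℕ} (g : Spec (.of F) ⟶ (P1Pow n).left)
    (hg : g ≫ (P1Pow n).hom = Spec.map (CommRingCat.ofHom (algebraMap ℂ F)))
    (htop : residueSubfield g = ⊤) (f : Fin n → F)
    (hf : ∀ i, residueSubfield (g ≫ P1Pow.proj n i) = ℂ⟮f i⟯.toSubfield) :
    adjoin ℂ (Set.range f) = ⊤ := by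
  let M := adjoin ℂ (Set.range f)
  let incl : CommRingCat.of M.toSubfield ⟶ .of F := CommRingCat.ofHom M.toSubfield.subtype
  let s : Spec (.of M.toSubfield) ⟶ Spec (.of ℂ) := Spec.map (CommRingCat.ofHom (algebraMap ℂ M))
  have hs : Spec.map incl ≫ s = Spec.map (CommRingCat.ofHom (algebraMap ℂ F)) := by
    rw [← Spec.map_comp]; rfl
  have hle : ∀ i, residueSubfield (g ≫ P1Pow.proj n i) ≤ M.toSubfield := fun i => by
    rw [hf]
    exact adjoin.mono ℂ _ _ (Set.singleton_subset_iff.2 ⟨i, rfl⟩)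
  -- Each component of the point is defined over `M`; the universal property of the product then
  -- makes the point itself defined over `M`, so `M` contains its residue field.
  choose g' hg' using fun i => (residueSubfield_le_iff _ _).1 (hle i)
  have hproj : ∀ i, P1Pow.proj n i ≫ P1.hom = (P1Pow n).hom := fun i => Over.w _
  have hw : ∀ i, g' i ≫ P1.hom = s := by
    intro i
    obtain ⟨φ, hφ⟩ := Spec.map_surjective (g' i ≫ P1.hom)
    have h1 : Spec.map incl ≫ g' i ≫ P1.hom = Spec.map incl ≫ s := by
      rw [← Category.assoc, hg', Category.assoc, hproj, hg, hs]
    rw [← hφ, ← Spec.map_comp, ← Spec.map_comp] at h1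
    have h2 := Spec.map_injective h1
    rw [← hφ]
    congr 1
    ext c
    have h3 := congrArg (fun f : CommRingCat.of ℂ ⟶ CommRingCat.of F => f.hom c) h2
    exact h3
  let l : Over.mk s ⟶ ∏ᶜ fun _ : Fin n => P1 := Pi.lift fun i => Over.homMk (g' i) (hw i)
  let a : Over.mk (Spec.map (CommRingCat.ofHom (algebraMap ℂ F))) ⟶ Over.mk s :=
    Over.homMk (Spec.map incl) hs
  let b : Over.mk (Spec.map (CommRingCat.ofHom (algebraMap ℂ F))) ⟶ ∏ᶜ fun _ : Fin n => P1 :=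
    Over.homMk g hg
  have hab : a ≫ l = b := by
    refine Pi.hom_ext _ _ fun i => ?_
    rw [Category.assoc, Pi.lift_π]
    ext1
    exact hg' i
  have hfac : Spec.map incl ≫ l.left = g := congrArg CommaMorphism.left hab
  have h4 := (residueSubfield_le_iff g M.toSubfield).2 ⟨l.left, hfac⟩
  rw [htop] at h4
  exact eq_top_iff.2 fun z _ => h4 (Subfield.mem_top z)

theorem finrank_eq_of_range_eq {O : Type} [CommRing O] (κ : O →+* F) (hκ : Function.Injective κ)
    (E : IntermediateField ℂ F) (hE : Set.range κ = E) :
    @Module.finrank O F _ _ κ.toAlgebra.toModule = Module.finrank E F := by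
  let _ := κ.toAlgebra
  have hmem : ∀ a, κ a ∈ E := fun a => by
    change κ a ∈ (E : Set F)
    rw [← hE]; exact ⟨a, rfl⟩
  let e : O ≃+* E := RingEquiv.ofBijective (κ.codRestrict E hmem)
    ⟨fun a b h => hκ (congrArg Subtype.val h), fun ⟨z, hz⟩ => by
      obtain ⟨a, rfl⟩ := hE.ge hz
      exact ⟨a, rfl⟩⟩
  exact Algebra.finrank_eq_of_equiv_equiv e (RingEquiv.refl F) (RingHom.ext fun _ => rfl)

theorem degree_eq_finrank {C Y : Scheme.{0}} [IsIntegral C] (h : C ⟶ Y)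
    [hdom : IsDominant h] (g : Spec (.of F) ⟶ C) (hg : g (closedPoint F) = genericPoint C)
    (hb : Function.Bijective (stalkClosedPointTo g).hom)
    (hinj : Function.Injective (stalkClosedPointTo (g ≫ h)).hom) (E : IntermediateField ℂ F)
    (hE : residueSubfield (g ≫ h) = E.toSubfield) : degree h = Module.finrank E F := by
  rw [degree_eq_finrank_stalkClosedPointTo h g hg hb]
  exact finrank_eq_of_range_eq _ hinj E (congrArg SetLike.coe hE)

theorem degree_eq_finrank_of_ne_zero {C Y : Scheme.{0}} [IsIntegral C] (h : C ⟶ Y)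
    (hd : degree h ≠ 0) (g : Spec (.of F) ⟶ C) (hg : g (closedPoint F) = genericPoint C)
    (hb : Function.Bijective (stalkClosedPointTo g).hom) (E : IntermediateField ℂ F)
    (hE : residueSubfield (g ≫ h) = E.toSubfield) : degree h = Module.finrank E F := by
  have : IsDominant h := by
    by_contra hdom
    exact hd (by rw [degree, if_neg hdom])
  refine degree_eq_finrank h g hg hb (injective_of_finrank_ne_zero _ ?_) E hE
  rwa [← degree_eq_finrank_stalkClosedPointTo h g hg hb]

end

end CurvePlace

end

noncomputable section

namespace CurvePlace

open IntermediateField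

/-! ### Regular differential forms and the valuative criterion -/

section

variable {k L : Type*} [Field k] [Field L] [Algebra k L] {V : ValuationSubring L}

theorem smul_mem_regularAt {a : L} (ha : a ∈ V) {ω : Ω[L⁄k]} (hω : ω ∈ regularAt k V) :
    a • ω ∈ regularAt k V := by
  induction hω using Submodule.span_induction with
  | mem ω h =>
    obtain ⟨b, hb, c, hc, rfl⟩ := h
    exact Submodule.subset_span ⟨a * b, mul_mem ha hb, c, hc, (mul_smul _ _ _).symm⟩
  | zero => rw [smul_zero]; exact zero_mem _
  | add u v _ _ hu hv => rw [smul_add]; exact add_mem hu hv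
  | smul c u _ hu => rw [smul_comm]; exact Submodule.smul_mem _ c hu

theorem range_map_le_regularAt {O : Type*} [CommRing O] [Algebra k O] [Algebra O L]
    [IsScalarTower k O L] (h : ∀ a : O, algebraMap O L a ∈ V) :
    LinearMap.range ((KaehlerDifferential.map k k O L).restrictScalars k) ≤ regularAt k V := by
  rintro _ ⟨η, rfl⟩
  have hη := (KaehlerDifferential.span_range_derivation k O).ge (Submodule.mem_top (x := η))
  change KaehlerDifferential.map k k O L η ∈ _
  induction hη using Submodule.span_induction with
  | mem η h' =>
    obtain ⟨a, rfl⟩ := h'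
    rw [KaehlerDifferential.map_D]
    exact Submodule.subset_span ⟨1, one_mem _, _, h a, (one_smul _ _).symm⟩
  | zero => rw [map_zero]; exact zero_mem _
  | add u v _ _ hu hv => rw [map_add]; exact add_mem hu hv
  | smul a u _ hu =>
    rw [map_smul, algebra_compatible_smul L a]
    exact smul_mem_regularAt (h a) hu

end

section

open CurveGenus Scheme IsLocalRing

theorem fromSpecStalk_comp_eq {X : Scheme.{0}} (π : X ⟶ Spec (.of ℂ)) (x : X) :
    X.fromSpecStalk x ≫ π =
      Spec.map (CommRingCat.ofHom (letI := stalkAlgebra π x; algebraMap ℂ (X.presheaf.stalk x))) := by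
  have h1 : π = X.toSpecΓ ≫ Spec.map ((ΓSpecIso (.of ℂ)).inv ≫ π.appTop) := by
    rw [Spec.map_comp, ← Category.assoc, ← Scheme.toSpecΓ_naturality, Category.assoc,
      ← SpecMap_ΓSpecIso_hom, ← Spec.map_comp, Iso.inv_hom_id, Spec.map_id, Category.comp_id]
  conv_lhs => rw [h1]
  rw [← Category.assoc, fromSpecStalk_toSpecΓ, ← Spec.map_comp, Category.assoc]
  rfl

/-- By the valuative criterion `V` has a center `y` on `X`. The local ring at `y` lies in `V`, so a
form regular at `y` is regular at `V`. -/
theorem regularDifferentials_le_regularAt {X : Scheme.{0}} [IsIntegral X] (π : X ⟶ Spec (.of ℂ))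
    [hπ : UniversallyClosed π] :
    letI := stalkAlgebra π (genericPoint X)
    ∀ V : ValuationSubring X.functionField, IsPlace ℂ V →
      regularDifferentials π ≤ regularAt ℂ V := by
  intro V hV
  let _ := stalkAlgebra π (genericPoint X)
  let q : Spec (.of X.functionField) ⟶ X := X.fromSpecStalk (genericPoint X)
  let c : ℂ →+* V := (algebraMap ℂ X.functionField).codRestrict V.toSubring hV.1
  let incl : CommRingCat.of V ⟶ .of X.functionField := CommRingCat.ofHom (algebraMap V X.functionField)
  have hq : q ≫ π = Spec.map incl ≫ Spec.map (CommRingCat.ofHom c) := by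
    rw [← Spec.map_comp]
    exact fromSpecStalk_comp_eq π (genericPoint X)
  have hex : ValuativeCriterion.Existence π := by
    rw [UniversallyClosed.eq_valuativeCriterion] at hπ
    exact hπ.1
  let S : ValuativeCommSq π :=
    { R := V
      K := X.functionField
      i₁ := q
      i₂ := Spec.map (CommRingCat.ofHom c)
      commSq := ⟨hq⟩ }
  obtain ⟨⟨l, hl, -⟩⟩ := (hex S).exists_lift
  let y : X := l (closedPoint V)
  have hspec : genericPoint X ⤳ y := (genericPoint_spec X).specializes trivial
  have h1 : stalkClosedPointTo l ≫ incl = X.presheaf.stalkSpecializes hspec := by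
    apply Spec.map_injective
    rw [← cancel_mono (X.fromSpecStalk y), SpecMap_stalkSpecializes_fromSpecStalk, Spec.map_comp,
      Category.assoc, Spec_stalkClosedPointTo_fromSpecStalk]
    exact hl
  have h2 : ∀ a : X.presheaf.stalk y, algebraMap (X.presheaf.stalk y) X.functionField a ∈ V := by
    intro a
    have h3 : algebraMap (X.presheaf.stalk y) X.functionField a =
        ((stalkClosedPointTo l).hom a : V) :=
      (congrArg (fun f : X.presheaf.stalk y ⟶ X.functionField => f.hom a) h1).symm
    rw [h3]
    exact ((stalkClosedPointTo l).hom a).2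
  let _ := stalkAlgebra π y
  have := stalk_isScalarTower π y
  exact (iInf_le _ y).trans (range_map_le_regularAt h2)

/-- Normalization is birational: `Spec K(C) → X` is dominant, so it hits the generic point and gives
`β : K(X) → K(C)`. The composite `K(C) → K(X) → K(C)` is onto and `β` is injective, so `K(C) → K(X)`
is bijective. -/
theorem bijective_stalkClosedPointTo_normalizationMap (C : Scheme.{0}) [IsIntegral C]
    [QuasiSeparatedSpace C] (q : Spec (.of (normalization C).functionField) ⟶ normalization C)
    (hq : q = (normalization C).fromSpecStalk (genericPoint (normalization C))) :
    (q ≫ normalizationMap C) (closedPoint (normalization C).functionField) = genericPoint C ∧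
      Function.Bijective (stalkClosedPointTo (q ≫ normalizationMap C)).hom := by
  let X := normalization C
  let j : Spec (.of C.functionField) ⟶ C := C.fromSpecStalk (genericPoint C)
  let t : Spec (.of C.functionField) ⟶ X := (C.fromSpecStalk (genericPoint C)).toNormalization
  have ht : t ≫ normalizationMap C = j := Scheme.Hom.toNormalization_fromNormalization _
  have htx : t (closedPoint C.functionField) = genericPoint X := by
    have hd : IsDominant t :=
      inferInstanceAs (IsDominant (C.fromSpecStalk (genericPoint C)).toNormalization)
    have hr : Set.range t = {t (closedPoint C.functionField)} := by
      refine Set.eq_singleton_iff_unique_mem.2 ⟨⟨_, rfl⟩, ?_⟩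
      rintro _ ⟨z, rfl⟩
      rw [show z = closedPoint C.functionField from
        Subsingleton.elim (α := PrimeSpectrum C.functionField) _ _]
    have h1 := hd.denseRange.closure_range
    rw [hr] at h1
    exact IsGenericPoint.eq h1 (genericPoint_spec X)
  obtain ⟨β, hβ⟩ : ∃ β : CommRingCat.of X.functionField ⟶ .of C.functionField,
      t = Spec.map β ≫ q := by
    have key : ∀ (x : X) (_ : x = genericPoint X)
        (κ : X.presheaf.stalk x ⟶ .of C.functionField),
        ∃ β : CommRingCat.of X.functionField ⟶ .of C.functionField,
          Spec.map κ ≫ X.fromSpecStalk x = Spec.map β ≫ q := by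
      rintro _ rfl κ
      exact ⟨κ, by rw [hq]⟩
    obtain ⟨β, hβ⟩ := key _ htx (stalkClosedPointTo t)
    exact ⟨β, by rw [← hβ, Spec_stalkClosedPointTo_fromSpecStalk]⟩
  have hj : j = Spec.map β ≫ q ≫ normalizationMap C := by
    rw [← ht, hβ, Category.assoc]
  have hpt : (q ≫ normalizationMap C) (closedPoint X.functionField) = genericPoint C := by
    have h1 : j (closedPoint C.functionField) = genericPoint C := fromSpecStalk_closedPoint
    rw [← h1, hj]
    rw [show closedPoint X.functionField = Spec.map β (closedPoint C.functionField) from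
        Subsingleton.elim (α := PrimeSpectrum X.functionField) _ _]
    rfl
  have hβinj : Function.Injective β.hom := RingHom.injective (R := X.functionField) β.hom
  have hlocal : IsLocalHom β.hom :=
    inferInstanceAs (IsLocalHom (β.hom : X.functionField →+* C.functionField))
  have hsurj : Function.Surjective (stalkClosedPointTo j).hom :=
    surjective_stalkClosedPointTo_fromSpecStalk C (genericPoint C)
  rw [← Set.range_eq_univ, hj, range_stalkClosedPointTo_specMap_comp] at hsurj
  refine ⟨hpt, ?_, ?_⟩
  · have key : ∀ (x : C) (_ : x = genericPoint C)
        (α : C.presheaf.stalk x ⟶ .of X.functionField), Function.Injective α.hom := by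
      rintro _ rfl α
      exact RingHom.injective (R := C.functionField) α.hom
    exact key _ hpt _
  · intro z
    obtain ⟨w, hw, hwz⟩ := hsurj.ge (Set.mem_univ (β.hom z))
    rw [← hβinj hwz]
    exact hw

end

end CurvePlace

end

noncomputable section

namespace CurvePlace

open IntermediateField

/-! ### Dimension and transcendence degree -/

/-- Lying over: a nonzero prime of `R` is the contraction of a nonzero, hence maximal, prime of `A`.
-/
theorem krullDimLE_one_of_isIntegral {R A : Type*} [CommRing R] [IsDomain R] [CommRing A]
    [IsDomain A] [Algebra R A] [FaithfulSMul R A] [Algebra.IsIntegral R A]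
    [Ring.KrullDimLE 1 A] : Ring.KrullDimLE 1 R := by
  rw [Ring.krullDimLE_one_iff_of_isPrime_bot]
  intro I hI hIp
  obtain ⟨Q, -, hQ, rfl⟩ := Ideal.exists_ideal_over_prime_of_isIntegral I (⊥ : Ideal A) (by
    rw [← RingHom.ker_eq_comap_bot,
      (RingHom.injective_iff_ker_eq_bot _).1 (FaithfulSMul.algebraMap_injective R A)]
    exact bot_le)
  have hQ0 : Q ≠ ⊥ := by
    rintro rfl
    refine hI ?_
    rw [← RingHom.ker_eq_comap_bot,
      (RingHom.injective_iff_ker_eq_bot _).1 (FaithfulSMul.algebraMap_injective R A)]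
  have := hQ.isMaximal_of_ne_bot hQ0
  exact Ideal.isMaximal_comap_of_isIntegral_of_isMaximal Q

/-- Noether normalization makes `A` integral over a polynomial ring in `s` variables, and the
dimension bound gives `s ≤ 1`. -/
theorem trdeg_le_one_of_krullDimLE_one {k : Type} {A L : Type} [Field k] [CommRing A] [IsDomain A]
    [Algebra k A] [Algebra.FiniteType k A] [Ring.KrullDimLE 1 A] [Field L] [Algebra k L]
    [Algebra A L] [IsScalarTower k A L] [IsFractionRing A L] : Algebra.trdeg k L ≤ 1 := by
  obtain ⟨s, φ, hφ, hint⟩ := exists_integral_inj_algHom_of_fg k A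
  let _ : Algebra (MvPolynomial (Fin s) k) A := φ.toAlgebra
  have : IsScalarTower k (MvPolynomial (Fin s) k) A := .of_algebraMap_eq' φ.comp_algebraMap.symm
  let _ : Algebra (MvPolynomial (Fin s) k) L := ((algebraMap A L).comp φ.toRingHom).toAlgebra
  have : IsScalarTower (MvPolynomial (Fin s) k) A L := .of_algebraMap_eq' rfl
  have : IsScalarTower k (MvPolynomial (Fin s) k) L := .to₁₂₄ k (MvPolynomial (Fin s) k) A L
  have : FaithfulSMul (MvPolynomial (Fin s) k) A := (faithfulSMul_iff_algebraMap_injective _ _).2 hφ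
  have : FaithfulSMul (MvPolynomial (Fin s) k) L := (faithfulSMul_iff_algebraMap_injective _ _).2
    ((IsFractionRing.injective A L).comp hφ)
  have : Algebra.IsIntegral (MvPolynomial (Fin s) k) A := ⟨hint⟩
  have hs : s ≤ 1 := by
    have h1 : Ring.KrullDimLE 1 (MvPolynomial (Fin s) k) := krullDimLE_one_of_isIntegral (A := A)
    have h2 := Order.KrullDimLE.krullDim_le (n := 1) (α := PrimeSpectrum (MvPolynomial (Fin s) k))
    change ringKrullDim _ ≤ _ at h2
    rw [MvPolynomial.ringKrullDim_of_isNoetherianRing, ringKrullDim_eq_zero_of_field, zero_add,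
      Nat.card_fin] at h2
    exact_mod_cast h2
  have : Algebra.IsAlgebraic (MvPolynomial (Fin s) k) L := by
    have : Algebra.IsAlgebraic A L :=
      (IsFractionRing.comap_isAlgebraic_iff (K := L)).2 inferInstance
    exact Algebra.IsAlgebraic.trans (MvPolynomial (Fin s) k) A L
  rw [← trdeg_add_eq k (MvPolynomial (Fin s) k) (A := L),
    trdeg_eq_zero (R := MvPolynomial (Fin s) k) (A := L), add_zero,
    MvPolynomial.trdeg_of_isDomain]
  simpa using hs

section

open CurveGenus Scheme IsLocalRing

theorem trdeg_functionField_le_one {C : Scheme.{0}} [IsIntegral C] (π : C ⟶ Spec (.of ℂ))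
    [LocallyOfFiniteType π] (hdim : topologicalKrullDim C ≤ 1) :
    letI := stalkAlgebra π (genericPoint C)
    Algebra.trdeg ℂ C.functionField ≤ 1 := by
  let _ := stalkAlgebra π (genericPoint C)
  obtain ⟨_, ⟨U, hU, rfl⟩, hxU, -⟩ := C.isBasis_affineOpens.exists_subset_of_mem_open
    (Set.mem_univ (genericPoint C)) isOpen_univ
  replace hU : IsAffineOpen U := hU
  have : Nonempty U := ⟨⟨_, hxU⟩⟩
  have hle : U ≤ π ⁻¹ᵁ ⊤ := le_top
  let γ : CommRingCat.of ℂ ⟶ Γ(C, U) := (ΓSpecIso (.of ℂ)).inv ≫ π.appLE ⊤ U hle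
  let _ : Algebra ℂ Γ(C, U) := γ.hom.toAlgebra
  have hft : Algebra.FiniteType ℂ Γ(C, U) := by
    have h1 := π.finiteType_appLE (isAffineOpen_top _) hU hle
    have h2 : (ΓSpecIso (.of ℂ)).inv.hom.FiniteType :=
      RingHom.FiniteType.of_surjective _
        (ConcreteCategory.bijective_of_isIso (ΓSpecIso (.of ℂ)).inv).2
    exact h1.comp h2
  have : IsFractionRing Γ(C, U) C.functionField := functionField_isFractionRing_of_isAffineOpen C U hU
  have : IsScalarTower ℂ Γ(C, U) C.functionField := by
    refine .of_algebraMap_eq' ?_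
    change ((ΓSpecIso (.of ℂ)).inv ≫ π.appTop ≫ C.presheaf.germ ⊤ _ _).hom =
      (((ΓSpecIso (.of ℂ)).inv ≫ π.appLE ⊤ U hle) ≫ C.presheaf.germ U _ hxU).hom
    congr 1
    rw [Category.assoc, Scheme.Hom.appLE, Category.assoc, TopCat.Presheaf.germ_res]
    rfl
  have : Ring.KrullDimLE 1 Γ(C, U) := by
    rw [Ring.krullDimLE_iff]
    rw [← PrimeSpectrum.topologicalKrullDim_eq_ringKrullDim]
    exact (hU.fromSpec.isOpenEmbedding.isInducing.topologicalKrullDim_le).trans hdim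
  exact trdeg_le_one_of_krullDimLE_one (A := Γ(C, U))

theorem trdeg_le_one_of_genericPoint {C : Scheme.{0}} [IsIntegral C] (π : C ⟶ Spec (.of ℂ))
    [LocallyOfFiniteType π] (hdim : topologicalKrullDim C ≤ 1) {F : Type} [Field F] [Algebra ℂ F]
    (g : Spec (.of F) ⟶ C) (hg : g (closedPoint F) = genericPoint C)
    (hb : Function.Bijective (stalkClosedPointTo g).hom)
    (hgπ : g ≫ π = Spec.map (CommRingCat.ofHom (algebraMap ℂ F))) : Algebra.trdeg ℂ F ≤ 1 := by
  have key : ∀ (x : C) (_ : x = genericPoint C) (α : C.presheaf.stalk x ⟶ .of F)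
      (_ : Function.Bijective α.hom)
      (_ : letI := stalkAlgebra π x
        α.hom.comp (algebraMap ℂ (C.presheaf.stalk x)) = algebraMap ℂ F),
      Algebra.trdeg ℂ F ≤ 1 := by
    rintro _ rfl α hα hc
    let _ := stalkAlgebra π (genericPoint C)
    let e : C.functionField ≃ₐ[ℂ] F := AlgEquiv.ofBijective
      { α.hom with commutes' := fun c => congrArg (fun f : ℂ →+* F => f c) hc } hα
    rw [← e.trdeg_eq]
    exact trdeg_functionField_le_one π hdim
  refine key _ hg _ hb ?_
  have h1 : Spec.map (stalkClosedPointTo g) ≫ C.fromSpecStalk _ ≫ π =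
      Spec.map (CommRingCat.ofHom (algebraMap ℂ F)) := by
    rw [← Category.assoc, Spec_stalkClosedPointTo_fromSpecStalk, hgπ]
  rw [fromSpecStalk_comp_eq, ← Spec.map_comp] at h1
  exact congrArg CommRingCat.Hom.hom (Spec.map_injective h1)

end

end CurvePlace

end

noncomputable section

namespace CurvePlace

open IntermediateField

/-! ### The bound for the geometric genus -/

section

variable {F : Type} [Field F] [Algebra ℂ F]

theorem toENat_rank_eq_zero_of_isAlgebraic (h : ∀ a : F, IsAlgebraic ℂ a)
    (W : Submodule ℂ (Ω[F⁄ℂ])) : Cardinal.toENat (Module.rank ℂ W) = 0 := by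
  have := subsingleton_kaehlerDifferential (k := ℂ) (L := F) fun a =>
    eq_algebraMap_of_isAlgebraic (h a)
  rw [rank_subsingleton', map_zero]

theorem toENat_rank_le_sq {n : ℕ} (hn : n ≠ 0) (f : Fin n → F)
    (htop : adjoin ℂ (Set.range f) = ⊤) (d : ℕ)
    (hd : d ≠ 0 → ∀ i, d = Module.finrank ℂ⟮f i⟯ F) (hd0 : d = 0 → ∀ i, IsAlgebraic ℂ (f i))
    (W : Submodule ℂ (Ω[F⁄ℂ]))
    (hW : ∀ V : ValuationSubring F, IsPlace ℂ V → W ≤ regularAt ℂ V) :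
    Cardinal.toENat (Module.rank ℂ W) ≤ ((d - 1) ^ 2 : ℕ) := by
  have hadj : ∀ i, IsAlgebraic ℂ (f i) → ℂ⟮f i⟯ = ⊥ := fun i hi => by
    obtain ⟨c, hc⟩ := eq_algebraMap_of_isAlgebraic hi
    exact adjoin_simple_eq_bot_iff.2 (mem_bot.2 ⟨c, hc⟩)
  -- For `d = 0` the natural number `(d - 1) ^ 2` is `0`, so all forms must vanish; they do, since
  -- every coordinate is constant and `F = ℂ`.
  by_cases h0 : d = 0
  · rw [toENat_rank_eq_zero_of_isAlgebraic]
    · exact zero_le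
    intro a
    have ha : a ∈ adjoin ℂ (Set.range f) := htop ▸ mem_top
    have hle : adjoin ℂ (Set.range f) ≤ ⊥ := by
      rw [adjoin_le_iff]
      rintro _ ⟨i, rfl⟩
      exact hadj i (hd0 h0 i) ▸ mem_adjoin_simple_self ℂ (f i)
    obtain ⟨c, rfl⟩ := mem_bot.1 (hle ha)
    exact isAlgebraic_algebraMap c
  have hfin : ∀ i, FiniteDimensional ℂ⟮f i⟯ F := fun i =>
    FiniteDimensional.of_finrank_pos (hd h0 i ▸ Nat.pos_of_ne_zero h0)
  by_cases hf : ∀ i, Transcendental ℂ (f i)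
  · obtain ⟨m, rfl⟩ := Nat.exists_eq_succ_of_ne_zero hn
    obtain ⟨h1, h2⟩ := finrank_logForms_le_sq f hf htop (Nat.pos_of_ne_zero h0)
      fun i => (hd h0 i).symm
    obtain ⟨φ, hφ⟩ := exists_linearMap_regularAt (hf 0) W hW
    have h3 := LinearMap.rank_le_of_injective φ hφ
    rw [← Module.finrank_eq_rank ℂ (logForms ℂ (f 0) ∅)] at h3
    calc Cardinal.toENat (Module.rank ℂ W)
        ≤ Cardinal.toENat (Module.finrank ℂ (logForms ℂ (f 0) ∅) : Cardinal) :=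
          Cardinal.toENat.monotone' h3
      _ = (Module.finrank ℂ (logForms ℂ (f 0) ∅) : ℕ∞) := Cardinal.toENat_nat _
      _ ≤ _ := by exact_mod_cast h2
  -- A constant coordinate of finite degree makes `F` algebraic over `ℂ`, so again there are no
  -- nonzero forms.
  · push Not at hf
    obtain ⟨i, hi⟩ := hf
    have hi' : IsAlgebraic ℂ (f i) := by
      by_contra h
      exact hi h
    rw [toENat_rank_eq_zero_of_isAlgebraic]
    · exact zero_le
    intro a
    have := hfin i
    have ha : IsAlgebraic ℂ⟮f i⟯ a := Algebra.IsAlgebraic.isAlgebraic a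
    have : Algebra.IsAlgebraic ℂ ℂ⟮f i⟯ := isAlgebraic_adjoin_simple hi'.isIntegral
    exact ha.restrictScalars ℂ

theorem finrank_adjoin_simple_ne_zero {n : ℕ} (f : Fin n → F)
    (htop : adjoin ℂ (Set.range f) = ⊤) (htr : Algebra.trdeg ℂ F ≤ 1) {t : F}
    (ht : Transcendental ℂ t) : Module.finrank ℂ⟮t⟯ F ≠ 0 := by
  have := isAlgebraic_adjoin htr ht
  have : Algebra.EssFiniteType ℂ F := by
    rw [← fg_top_iff, ← htop]
    exact fg_adjoin_of_finite (Set.finite_range f)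
  have : Algebra.EssFiniteType ℂ⟮t⟯ F := Algebra.EssFiniteType.of_comp ℂ _ _
  have : FiniteDimensional ℂ⟮t⟯ F := Algebra.finite_of_essFiniteType_of_isAlgebraic
  exact Module.finrank_pos.ne'

end

open CurveGenus Scheme IsLocalRing

/-- Integral morphisms are universally closed, which makes the valuative criterion available on the
normalization. -/
instance (C : Scheme.{0}) [IsIntegral C] [QuasiSeparatedSpace C] :
    IsIntegralHom (normalizationMap C) :=
  inferInstanceAs (IsIntegralHom (C.fromSpecStalk (genericPoint C)).fromNormalization)

theorem geometricGenus_le_sq {n : ℕ} (hn : n ≠ 0) (d : ℕ) {C : Scheme.{0}} [IsIntegral C]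
    (ι : C ⟶ (P1Pow n).left) [IsClosedImmersion ι] (hdim : topologicalKrullDim C ≤ 1)
    (hdeg : ∀ i : Fin n, CurveGenus.degree (ι ≫ P1Pow.proj n i) = d) :
    geometricGenus (ι ≫ (P1Pow n).hom) ≤ ((d - 1) ^ 2 : ℕ) := by
  let π := ι ≫ (P1Pow n).hom
  have : QuasiSeparatedSpace C := quasiSeparatedSpace_of_quasiSeparated π
  let X := normalization C
  let π' : X ⟶ Spec (.of ℂ) := normalizationMap C ≫ π
  let _ := stalkAlgebra π' (genericPoint X)
  let F := X.functionField
  let q : Spec (.of F) ⟶ X := X.fromSpecStalk (genericPoint X)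
  obtain ⟨hg, hb⟩ := bijective_stalkClosedPointTo_normalizationMap C q rfl
  let g : Spec (.of F) ⟶ C := q ≫ normalizationMap C
  have hgπ : g ≫ π = Spec.map (CommRingCat.ofHom (algebraMap ℂ F)) := by
    rw [Category.assoc]
    exact fromSpecStalk_comp_eq π' (genericPoint X)
  have hproj : ∀ i, P1Pow.proj n i ≫ P1.hom = (P1Pow n).hom := fun i => Over.w _
  have hcoord : ∀ i, (g ≫ ι ≫ P1Pow.proj n i) ≫ P1.hom =
      Spec.map (CommRingCat.ofHom (algebraMap ℂ F)) := fun i => by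
    rw [← hgπ]
    simp only [π, Category.assoc, hproj]
  choose f hf hgen using fun i => exists_residueSubfield_eq_adjoin_simple _ (hcoord i)
  have hres : residueSubfield g = ⊤ := eq_top_iff.2 fun z _ => hb.2 z
  have htop : adjoin ℂ (Set.range f) = ⊤ := by
    refine adjoin_range_eq_top_of_residueSubfield (g ≫ ι) ?_ ?_ f fun i => ?_
    · rw [Category.assoc, ← hgπ]
    · rw [residueSubfield_comp_of_surjective, hres]
      exact ι.stalkMap_surjective _
    · rw [Category.assoc, hf]
  refine toENat_rank_le_sq hn f htop d (fun hd i => ?_) (fun hd i => ?_) _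
    (regularDifferentials_le_regularAt π')
  · rw [← hdeg i]
    exact degree_eq_finrank_of_ne_zero _ (hdeg i ▸ hd) g hg hb _ (hf i)
  -- The value `degree = 0` could also come from a dominant map of infinite degree; transcendence
  -- degree at most one excludes this.
  · by_contra ht
    obtain ⟨hinj, hcl⟩ := hgen i ht
    have hdom : IsDominant (ι ≫ P1Pow.proj n i) := by
      refine ⟨dense_iff_closure_eq.2 (Set.eq_univ_of_univ_subset ?_)⟩
      rw [← hcl]
      refine closure_mono (Set.singleton_subset_iff.2 ⟨g (closedPoint F), rfl⟩)
    have h1 := degree_eq_finrank _ g hg hb hinj _ (hf i)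
    rw [hdeg i, hd] at h1
    exact finrank_adjoin_simple_ne_zero f htop (trdeg_le_one_of_genericPoint π hdim g hg hb hgπ) ht
      h1.symm

end CurvePlace

end

theorem mainTheorem7 (n : ℕ) (hn : 2 ≤ n) (d : ℕ)
    (C : Scheme.{0}) [IsIntegral C] (ι : C ⟶ (CurveGenus.P1Pow n).left) [IsClosedImmersion ι]
    (hdim : topologicalKrullDim C = 1)
    (hdeg : ∀ i : Fin n, CurveGenus.degree (ι ≫ CurveGenus.P1Pow.proj n i) = d) :
    CurveGenus.geometricGenus (ι ≫ (CurveGenus.P1Pow n).hom) ≤ (((d - 1) ^ 2 : ℕ) : ℕ∞) :=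
  CurvePlace.geometricGenus_le_sq (by omega) d ι hdim.le hdeg
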